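/- Let $3\le n<\omega$. Let $P$ be the set of partial functions $f:\mathbb Z\to\mathbb N$ with $|\mathrm{dom} f|\le 2$ that are order preserving ($i<j\Rightarrow f(i)<f(j)$). The edge colours are: greens $g_i$ ($1\le i\le n-2$) and $g_0^t$ ($t\in\mathbb Z$); whites $w$ and $w_f$ ($f\in P$); yellow $y$; black $b$; reds $r_{ij}$ ($i,j\in\mathbb N$). The shades of yellow are $y_S$, where $S\subseteq\mathbb Z$ is finite or $S=\mathbb Z$. In a coloured graph $\Gamma$ some edges $(x,y)$, $x\ne y$, have a unique edge colour $\Gamma(x,y)$, where $\Gamma(x,y)=r_{ij}$ iff $\Gamma(y,x)=r_{ji}$ and all other colours are symmetric, and some $(n-1)$-tuples of nodes have a unique shade of yellow. Distinct nodes $d_0,\dots,d_{n-2},z$ form a $t$-cone with base $(d_0,\dots,d_{n-2})$ and apex $z$ if $\Gamma(d_0,z)=g_0^t$, $\Gamma(d_j,z)=g_j$ for $1\le j\le n-2$, and no edge between the $d_j$ is green. Let $\mathbf J$ be the class of coloured graphs such that: 1. every edge is coloured; 2. there is no triangle of distinct nodes $x,y,z$ for which the triple $(\Gamma(x,y),\Gamma(x,z),\Gamma(y,z))$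 has one of the following forms: three greens; $(g_i,g_i,\text{any white})$; $(g_0^s,g_0^t,\text{any white})$; $(g_0^t,y,w_f)$ with $t\notin\mathrm{dom} f$; $(g_0^i,g_0^j,r_{kl})$ where $\{(i,k),(j,l)\}$ is not an order preserving partial function; $(y,y,y)$; $(y,y,b)$; $(r_{ij},r_{i^*k^*},r_{j'k'})$ unless $i=i^*$, $j=j'$ and $k'=k^*$; 3. an $(n-1)$-tuple has a shade of yellow iff its entries are distinct and no edge between them is green; 4. if the base of a $t$-cone has shade $y_S$, then $t\in S$. Let $K$ be the set of surjections $a$ from $n=\{0,\dots,n-1\}$ onto some $\Gamma_a\in\mathbf J$ with nodes in $\omega$. For $I\subseteq n$, say that $a,b\in K$ agree on $I$ if for indices in $I$ we have $a(i)=a(j)\iff b(i)=b(j)$, and the colours of the edges $(a(i),a(j))$, $(b(i),b(j))$ and the shades of the tuples $(a(k_0),\dots,a(k_{n-2}))$, $(b(k_0),\dots,b(k_{n-2}))$ coincide (both undefined, or both defined and equal). Let $[a]$ be the class of $a$ under agreement on $n$; put $[a]\,T_i\,[b]$ iff $a,b$ agree on $n\setminus\{i\}$, and $[a]\in E_{ij}$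 iff $a(i)=a(j)$. Let $\mathfrak C_n$ be the complex algebra of this atom structure: the Boolean algebra of all sets of classes with ${\sf c}_iX=\{x:\exists z\in X,\ x\,T_i\,z\}$ and ${\sf d}_{ij}=E_{ij}$. An atomic network over an atom structure $\alpha$ consists of a set $\Delta$ of nodes and a map $N:{}^n\Delta\to\alpha$ with $N(\delta[j\to\delta_i])\le{\sf d}_{ij}$ and $N(\delta[i\to d])\le{\sf c}_iN(\delta)$ for all $i,j<n$, $\delta\in{}^n\Delta$, $d\in\Delta$. In the $m$-pebble game $F^m(\alpha)$, with $\omega$ rounds, $\forall$ first picks an atom $a$, and $\exists$ must play an atomic network $N_0$ with nodes in $\{0,\dots,m-1\}$ and some $n$-tuple of nodes labelled $a$. In each later round $\forall$ picks a previously played network $N$, an index $l<n$, a face $f_0,\dots,f_{n-2}$ of nodes of $N$, a pebble $k<m$ not among the $f_i$ (possibly a node of $N$), and an atom $b\le{\sf c}_lN(f_0,\dots,f_{l-1},x,f_l,\dots,f_{n-2})$, with $x$ any node of $N$; $\exists$ must play an atomic network $M$ with set of nodes that of $N$ together with $k$, which agrees with $N$ on all tuples of nodes of $N$ not involving $k$,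 and such that $M(f_0,\dots,f_{l-1},k,f_l,\dots,f_{n-2})=b$. $\exists$ wins if she responds legally in every round; otherwise $\forall$ wins. For algebras of cylindric type, $S_c\mathrm{Nr}_n\mathrm{CA}_{n+2}$ is the class of algebras isomorphic to a subalgebra $\mathfrak A$ of the neat $n$-reduct $\mathrm{Nr}_n\mathfrak D$ of some $(n+2)$-dimensional cylindric algebra $\mathfrak D$ such that every supremum existing in $\mathfrak A$ is also the supremum in $\mathrm{Nr}_n\mathfrak D$. An $n$-dimensional algebra is completely representable if it has an injective homomorphism, turning every existing supremum into a union, into the full set algebra on a union of cartesian spaces ${}^nU_t$ with pairwise disjoint $U_t$. **Theorem.** For every finite $n\ge 3$: (i) $\forall$ has a winning strategy in $F^{n+2}(\mathrm{At}\,\mathfrak C_n)$; (ii) $\mathfrak C_n\notin S_c\mathrm{Nr}_n\mathrm{CA}_{n+2}$; (iii) $\mathfrak C_n$ is not completely representable. -/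

import Mathlib

universe u v

/-! ### Cylindric algebras -/

/-- The non-Boolean operations (cylindrifications and diagonal elements) of an algebra of
cylindric type with set of dimensions `ι`; no law is imposed. -/
class CylindricOps (ι : Type*) (A : Type*) where
  cyl : ι → A → A
  diag : ι → ι → A

/-- Cylindric algebras of dimension `ι` (the axioms of Henkin, Monk and Tarski). -/
class CylindricAlgebra (ι : Type*) (A : Type*) [BooleanAlgebra A] extends CylindricOps ι A where
  cyl_bot : ∀ i : ι, cyl i ⊥ = ⊥
  le_cyl : ∀ (i : ι) (x : A), x ≤ cyl i x
  cyl_inf_cyl : ∀ (i : ι) (x y : A), cyl i (x ⊓ cyl i y) = cyl i x ⊓ cyl i y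
  cyl_comm : ∀ (i j : ι) (x : A), cyl i (cyl j x) = cyl j (cyl i x)
  diag_self : ∀ i : ι, diag i i = ⊤
  diag_eq : ∀ i j k : ι, k ≠ i → k ≠ j → diag i j = cyl k (diag i k ⊓ diag k j)
  cyl_diag : ∀ (i j : ι) (x : A), i ≠ j → cyl i (diag i j ⊓ x) ⊓ cyl i (diag i j ⊓ xᶜ) = ⊥

namespace CylindricAlgebra

theorem cyl_top {ι A : Type*} [BooleanAlgebra A] [CylindricAlgebra ι A] (i : ι) :
    CylindricOps.cyl i (⊤ : A) = ⊤ :=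
  top_le_iff.mp (le_cyl i ⊤)

theorem cyl_cyl {ι A : Type*} [BooleanAlgebra A] [CylindricAlgebra ι A] (i : ι) (x : A) :
    CylindricOps.cyl i (CylindricOps.cyl i x) = CylindricOps.cyl i x := by
  have h := cyl_inf_cyl i (⊤ : A) x
  rwa [top_inf_eq, cyl_top, top_inf_eq] at h

theorem cyl_inf_of_fixed {ι A : Type*} [BooleanAlgebra A] [CylindricAlgebra ι A] {i : ι} {x y : A}
    (hx : CylindricOps.cyl i x = x) (hy : CylindricOps.cyl i y = y) :
    CylindricOps.cyl i (x ⊓ y) = x ⊓ y := by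
  have h := cyl_inf_cyl i x y
  rwa [hy, hx] at h

theorem cyl_compl_of_fixed {ι A : Type*} [BooleanAlgebra A] [CylindricAlgebra ι A] {i : ι} {x : A}
    (hx : CylindricOps.cyl i x = x) : CylindricOps.cyl i xᶜ = xᶜ := by
  have h := cyl_inf_cyl i xᶜ x
  rw [hx, compl_inf_self, cyl_bot] at h
  exact le_antisymm (le_compl_iff_disjoint_right.mpr (disjoint_iff.mpr h.symm)) (le_cyl i _)

theorem cyl_sup_of_fixed {ι A : Type*} [BooleanAlgebra A] [CylindricAlgebra ι A] {i : ι} {x y : A}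
    (hx : CylindricOps.cyl i x = x) (hy : CylindricOps.cyl i y = y) :
    CylindricOps.cyl i (x ⊔ y) = x ⊔ y := by
  have h := cyl_compl_of_fixed (cyl_inf_of_fixed (cyl_compl_of_fixed hx) (cyl_compl_of_fixed hy))
  rwa [compl_inf, compl_compl, compl_compl] at h

theorem cyl_diag_of_ne {ι A : Type*} [BooleanAlgebra A] [CylindricAlgebra ι A] {i j k : ι}
    (hi : k ≠ i) (hj : k ≠ j) :
    CylindricOps.cyl k (CylindricOps.diag i j : A) = CylindricOps.diag i j := by
  rw [diag_eq i j k hi hj, cyl_cyl]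

end CylindricAlgebra

/-- The universe of the neat `n`-reduct of an `(n + k)`-dimensional cylindric algebra `D`:
the elements fixed by all the cylindrifications `c_j` with `n ≤ j`. -/
def neatReduct (n k : ℕ) (D : Type*) [BooleanAlgebra D] [CylindricAlgebra (Fin (n + k)) D] :
    BooleanSubalgebra D where
  carrier := {x | ∀ j : Fin (n + k), n ≤ j.val → CylindricOps.cyl j x = x}
  supClosed' := fun _ hx _ hy j hj => CylindricAlgebra.cyl_sup_of_fixed (hx j hj) (hy j hj)
  infClosed' := fun _ hx _ hy j hj => CylindricAlgebra.cyl_inf_of_fixed (hx j hj) (hy j hj)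
  compl_mem' := fun hx j hj => CylindricAlgebra.cyl_compl_of_fixed (hx j hj)
  bot_mem' := fun j _ => CylindricAlgebra.cyl_bot j

/-- The neat `n`-reduct keeps the cylindrifications and diagonal elements with indices `< n`. -/
instance neatReductOps (n k : ℕ) (D : Type*) [BooleanAlgebra D]
    [CylindricAlgebra (Fin (n + k)) D] : CylindricOps (Fin n) (neatReduct n k D) where
  cyl i x := ⟨CylindricOps.cyl (Fin.castAdd k i) x.1, fun j hj => by
    rw [CylindricAlgebra.cyl_comm, x.2 j hj]⟩
  diag i i' := ⟨CylindricOps.diag (Fin.castAdd k i) (Fin.castAdd k i'), fun j hj =>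
    CylindricAlgebra.cyl_diag_of_ne
      (fun h => by have := i.isLt; rw [h, Fin.val_castAdd] at hj; omega)
      (fun h => by have := i'.isLt; rw [h, Fin.val_castAdd] at hj; omega)⟩

/-- `e` is an isomorphism of `A` onto a complete subalgebra of `B`: an injective homomorphism
of cylindric-type algebras that preserves every supremum which exists in `A`. -/
structure IsCompleteEmbedding (ι : Type*) {A B : Type*} [BooleanAlgebra A] [CylindricOps ι A]
    [BooleanAlgebra B] [CylindricOps ι B] (e : A → B) : Prop where
  injective : Function.Injective e
  map_sup : ∀ x y, e (x ⊔ y) = e x ⊔ e y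
  map_compl : ∀ x, e xᶜ = (e x)ᶜ
  map_cyl : ∀ (i : ι) (x : A), e (CylindricOps.cyl i x) = CylindricOps.cyl i (e x)
  map_diag : ∀ i j : ι, e (CylindricOps.diag i j) = CylindricOps.diag i j
  map_isLUB : ∀ (X : Set A) (a : A), IsLUB X a → IsLUB (e '' X) (e a)

/-- `A ∈ S_c Nr_n CA_{n+k}`: up to isomorphism, `A` is a complete subalgebra of the neat
`n`-reduct of some `(n + k)`-dimensional cylindric algebra (with universe in `Type v`). -/
def IsCompleteSubNeatReduct (n k : ℕ) (A : Type u) [BooleanAlgebra A]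
    [CylindricOps (Fin n) A] : Prop :=
  ∃ (D : Type v) (_ : BooleanAlgebra D) (_ : CylindricAlgebra (Fin (n + k)) D)
    (e : A → neatReduct n k D), IsCompleteEmbedding (Fin n) e

/-- The unit of a generalized set algebra: the union of the cartesian spaces `ⁿ(W t)`. -/
def genCartesianSpace (n : ℕ) {I U : Type*} (W : I → Set U) : Set (Fin n → U) :=
  {s | ∃ t, ∀ i, s i ∈ W t}

/-- The full set algebra with unit `V`: all subsets of `V`. -/
def FullSetAlgebra {n : ℕ} {U : Type*} (V : Set (Fin n → U)) : Type _ := Set V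

instance {n : ℕ} {U : Type*} (V : Set (Fin n → U)) : BooleanAlgebra (FullSetAlgebra V) :=
  inferInstanceAs (BooleanAlgebra (Set V))

instance {n : ℕ} {U : Type*} (V : Set (Fin n → U)) :
    CylindricOps (Fin n) (FullSetAlgebra V) where
  cyl i (X : Set V) := {s : V | ∃ t ∈ X, ∀ j, j ≠ i → t.1 j = s.1 j}
  diag i j := {s : V | s.1 i = s.1 j}

/-- `A` is completely representable: it has a representation as a generalized set algebra, with
unit a union of pairwise disjoint cartesian spaces, that turns existing suprema into unions
(the base of the representation being in `Type v`). -/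
def IsCompletelyRepresentable (n : ℕ) (A : Type u) [BooleanAlgebra A]
    [CylindricOps (Fin n) A] : Prop :=
  ∃ (I U : Type v) (W : I → Set U), Pairwise (fun s t => Disjoint (W s) (W t)) ∧
    ∃ e : A → FullSetAlgebra (genCartesianSpace n W), IsCompleteEmbedding (Fin n) e

/-! ### Atom structures -/

/-- An atom structure of the type of `n`-dimensional cylindric algebras. -/
structure CylAtomStructure (n : ℕ) where
  Atom : Type u
  rel : Fin n → Atom → Atom → Prop
  diag : Fin n → Fin n → Set Atom

/-- The (full) complex algebra of an atom structure: all sets of atoms. -/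
def ComplexAlgebra {n : ℕ} (S : CylAtomStructure.{u} n) : Type u := Set S.Atom

instance {n : ℕ} (S : CylAtomStructure.{u} n) : BooleanAlgebra (ComplexAlgebra S) :=
  inferInstanceAs (BooleanAlgebra (Set S.Atom))

instance {n : ℕ} (S : CylAtomStructure.{u} n) : CylindricOps (Fin n) (ComplexAlgebra S) where
  cyl i (X : Set S.Atom) := {a | ∃ b ∈ X, S.rel i a b}
  diag i j := S.diag i j

/-- `At A`, the atom structure of `A`. -/
def atomStructure (n : ℕ) (A : Type u) [BooleanAlgebra A] [CylindricOps (Fin n) A] :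
    CylAtomStructure.{u} n where
  Atom := {a : A // IsAtom a}
  rel i a b := a.1 ≤ CylindricOps.cyl i b.1
  diag i j := {a | a.1 ≤ CylindricOps.diag i j}

/-! ### Atomic networks and the game `F^m` -/

/-- A finite atomic network whose nodes are natural numbers. Only the labels of the tuples of
nodes matter; `label` has arbitrary values on the other tuples. -/
structure AtomicNetwork {n : ℕ} (S : CylAtomStructure.{u} n) where
  nodes : Finset ℕ
  label : (Fin n → ℕ) → S.Atom
  label_diag : ∀ (i j : Fin n) (δ : Fin n → ℕ), (∀ p, δ p ∈ nodes) →
    label (Function.update δ j (δ i)) ∈ S.diag i j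
  label_cyl : ∀ (i : Fin n) (δ : Fin n → ℕ) (d : ℕ), (∀ p, δ p ∈ nodes) → d ∈ nodes →
    S.rel i (label (Function.update δ i d)) (label δ)

/-- A cylindrifier move of `∀`: a network `N`, an index `l`, a face, a node `k` and an atom `b`.
The face is given by the tuple `δ`, of which the entry `δ l` (an arbitrary node) is disregarded. -/
structure CylindrifierMove {n : ℕ} (S : CylAtomStructure.{u} n) where
  N : AtomicNetwork S
  l : Fin n
  δ : Fin n → ℕ
  k : ℕ
  b : S.Atom

/-- The move is legal with `m` pebbles when `played` are the networks played so far. -/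
structure CylindrifierMove.Legal {n : ℕ} {S : CylAtomStructure.{u} n} (m : ℕ)
    (played : List (AtomicNetwork S)) (μ : CylindrifierMove S) : Prop where
  mem_played : μ.N ∈ played
  face_mem : ∀ p, μ.δ p ∈ μ.N.nodes
  pebble_lt : μ.k < m
  pebble_ne : ∀ p, p ≠ μ.l → μ.k ≠ μ.δ p
  atom_le : S.rel μ.l μ.b (μ.N.label μ.δ)

/-- `M` is a legal response of `∃` to the move: `M` and `N` agree on all nodes other than `k`
(the pebble `k` is reused if it was a node of `N`), and the demanded hyperedge has label `b`. -/
structure CylindrifierMove.Response {n : ℕ} {S : CylAtomStructure.{u} n}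
    (μ : CylindrifierMove S) (M : AtomicNetwork S) : Prop where
  nodes_eq : M.nodes = insert μ.k μ.N.nodes
  agree : ∀ δ : Fin n → ℕ, (∀ p, δ p ∈ μ.N.nodes ∧ δ p ≠ μ.k) → M.label δ = μ.N.label δ
  label_eq : M.label (Function.update μ.δ μ.l μ.k) = μ.b

/-- `M` is a legal response of `∃` to the choice of the atom `a` in the initial round. -/
def InitialResponse {n : ℕ} {S : CylAtomStructure.{u} n} (m : ℕ) (a : S.Atom)
    (M : AtomicNetwork S) : Prop :=
  M.nodes ⊆ Finset.range m ∧ ∃ d : Fin n → ℕ, (∀ p, d p ∈ M.nodes) ∧ M.label d = a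

/-- A strategy for `∀`: an initial atom, and a move for every list `N_0, …, N_r` of networks
played by `∃` so far. -/
structure ForallStrategy {n : ℕ} (S : CylAtomStructure.{u} n) where
  init : S.Atom
  move : List (AtomicNetwork S) → CylindrifierMove S

/-- `∃` has responded legally with `N 0, …, N r` in the rounds `0, …, r` of a play in which `∀`
uses `σ`. -/
def ForallStrategy.Survives {n : ℕ} {S : CylAtomStructure.{u} n} (m : ℕ) (σ : ForallStrategy S)
    (N : ℕ → AtomicNetwork S) (r : ℕ) : Prop :=
  InitialResponse m σ.init (N 0) ∧
    ∀ s < r, (σ.move ((List.range (s + 1)).map N)).Response (N (s + 1))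

/-- `∀` has a winning strategy in the game `F^m` with `ω` rounds on the atom structure `S`: one
that always gives him legal moves and such that `∃` cannot respond legally in all rounds. -/
def ForallWinsF {n : ℕ} (m : ℕ) (S : CylAtomStructure.{u} n) : Prop :=
  ∃ σ : ForallStrategy S, ∀ N : ℕ → AtomicNetwork S,
    (∀ r, σ.Survives m N r →
      (σ.move ((List.range (r + 1)).map N)).Legal m ((List.range (r + 1)).map N)) ∧
    ∃ r, ¬ σ.Survives m N r

/-! ### Rainbow colours and coloured graphs -/

namespace Rainbow

/-- The partial order preserving functions `f : ℤ → ℕ` with `|dom f| ≤ 2`. -/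
def P : Type :=
  {f : ℤ → Option ℕ // (∀ i j a b, f i = some a → f j = some b → i < j → a < b) ∧
    {i | f i ≠ none}.encard ≤ 2}

/-- The edge colours: greens `g_i` (`1 ≤ i ≤ n - 2`) and `g_0^t` (`t ∈ ℤ`), whites `w` and `w_f`
(`f ∈ P`), yellow `y`, black `b`, reds `r_ij` (`i, j ∈ ℕ`). -/
inductive EdgeColour (n : ℕ) : Type
  | green (i : ℕ) (h : 1 ≤ i ∧ i ≤ n - 2)
  | greenZero (t : ℤ)
  | white
  | whiteFun (f : P)
  | yellow
  | black
  | red (i j : ℕ)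

namespace EdgeColour

/-- The colour of an edge read in the other direction: `r_ij` becomes `r_ji`, all other colours
are symmetric. -/
def conv {n : ℕ} : EdgeColour n → EdgeColour n
  | red i j => red j i
  | c => c

inductive IsGreen {n : ℕ} : EdgeColour n → Prop
  | green (i : ℕ) (h : 1 ≤ i ∧ i ≤ n - 2) : IsGreen (green i h)
  | greenZero (t : ℤ) : IsGreen (greenZero t)

inductive IsWhite {n : ℕ} : EdgeColour n → Prop
  | white : IsWhite white
  | whiteFun (f : P) : IsWhite (whiteFun f)

end EdgeColour

open EdgeColour in
/-- The forbidden triangles: the arguments are the colours of `(x, y)`, `(x, z)`, `(y, z)`.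
In `redGreen`, `{(i, k), (j, l)}` is not an order preserving partial function. -/
inductive Forbidden {n : ℕ} : EdgeColour n → EdgeColour n → EdgeColour n → Prop
  | greens {c c' c''} : IsGreen c → IsGreen c' → IsGreen c'' → Forbidden c c' c''
  | greenWhite (i : ℕ) (h : 1 ≤ i ∧ i ≤ n - 2) {c} : IsWhite c →
      Forbidden (green i h) (green i h) c
  | greenZeroWhite (s t : ℤ) {c} : IsWhite c → Forbidden (greenZero s) (greenZero t) c
  | greenZeroYellow (t : ℤ) (f : P) : f.1 t = none →
      Forbidden (greenZero t) yellow (whiteFun f)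
  | redGreen (i j : ℤ) (k l : ℕ) :
      ¬ ((i = j → k = l) ∧ (i < j → k < l) ∧ (j < i → l < k)) →
      Forbidden (greenZero i) (greenZero j) (red k l)
  | yellows : Forbidden yellow yellow yellow
  | yellowBlack : Forbidden yellow yellow black
  | reds (i j j' k' i'' k'' : ℕ) : ¬ (i = i'' ∧ j = j' ∧ k' = k'') →
      Forbidden (red i j) (red i'' k'') (red j' k')

/-- The index sets of the shades of yellow `y_S`: finite sets of integers, and `ℤ` itself. -/
def Shade : Type := {S : Set ℤ // S.Finite ∨ S = Set.univ}

/-- A coloured graph with set of nodes `V`: some edges (pairs of distinct nodes) carry an edge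
colour and some `(n - 1)`-tuples of nodes carry a shade of yellow. -/
structure ColouredGraph (n : ℕ) (V : Type*) where
  edge : V → V → Option (EdgeColour n)
  shade : (Fin (n - 1) → V) → Option Shade
  edge_self : ∀ x, edge x x = none
  edge_symm : ∀ x y, edge y x = (edge x y).map EdgeColour.conv

namespace ColouredGraph

variable {n : ℕ} {V : Type*}

/-- The edge between `x` and `y` is coloured green. -/
def GreenEdge (Γ : ColouredGraph n V) (x y : V) : Prop :=
  ∃ c, Γ.edge x y = some c ∧ c.IsGreen

/-- The distinct nodes `d_0, …, d_{n-2}, z` form a cone with centre `(d_0, …, d_{n-2})`, apex `z`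
and tint `t`. -/
structure IsCone (Γ : ColouredGraph n V) (d : Fin (n - 1) → V) (z : V) (t : ℤ) : Prop where
  injective : Function.Injective d
  apex_ne : ∀ p, d p ≠ z
  edge_zero : ∀ p : Fin (n - 1), p.val = 0 → Γ.edge (d p) z = some (EdgeColour.greenZero t)
  edge_pos : ∀ (p : Fin (n - 1)) (h : 1 ≤ p.val ∧ p.val ≤ n - 2),
    Γ.edge (d p) z = some (EdgeColour.green p.val h)
  base_not_green : ∀ p q, ¬ Γ.GreenEdge (d p) (d q)

/-- The class `J` of coloured graphs. -/
structure InJ (Γ : ColouredGraph n V) : Prop where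
  complete : ∀ x y, x ≠ y → Γ.edge x y ≠ none
  no_forbidden : ∀ x y z, ∀ c c' c'', Γ.edge x y = some c → Γ.edge x z = some c' →
    Γ.edge y z = some c'' → ¬ Forbidden c c' c''
  shade_iff : ∀ d : Fin (n - 1) → V, Γ.shade d ≠ none ↔
    (Function.Injective d ∧ ∀ p q, ¬ Γ.GreenEdge (d p) (d q))
  cone : ∀ (d : Fin (n - 1) → V) (z : V) (t : ℤ) (S : Shade), Γ.IsCone d z t →
    Γ.shade d = some S → t ∈ S.1

end ColouredGraph

/-! ### The rainbow atom structure and the algebra `C_n` -/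

/-- The surjections from `n` onto the coloured graphs in `J` with nodes in `ω`. -/
structure GraphMap (n : ℕ) where
  nodes : Set ℕ
  graph : ColouredGraph n nodes
  inJ : graph.InJ
  map : Fin n → nodes
  surjective : Function.Surjective map

/-- `a` and `b` induce the same coloured graph on the set of indices `I`. -/
structure GraphMap.AgreeOn {n : ℕ} (I : Set (Fin n)) (a b : GraphMap n) : Prop where
  eq_iff : ∀ i ∈ I, ∀ j ∈ I, (a.map i = a.map j ↔ b.map i = b.map j)
  edge_eq : ∀ i ∈ I, ∀ j ∈ I,
    a.graph.edge (a.map i) (a.map j) = b.graph.edge (b.map i) (b.map j)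
  shade_eq : ∀ k : Fin (n - 1) → Fin n, (∀ p, k p ∈ I) →
    a.graph.shade (fun p => a.map (k p)) = b.graph.shade (fun p => b.map (k p))

theorem GraphMap.AgreeOn.refl {n : ℕ} (I : Set (Fin n)) (a : GraphMap n) : AgreeOn I a a :=
  ⟨fun _ _ _ _ => Iff.rfl, fun _ _ _ _ => rfl, fun _ _ => rfl⟩

theorem GraphMap.AgreeOn.symm {n : ℕ} {I : Set (Fin n)} {a b : GraphMap n}
    (h : AgreeOn I a b) : AgreeOn I b a :=
  ⟨fun i hi j hj => (h.eq_iff i hi j hj).symm, fun i hi j hj => (h.edge_eq i hi j hj).symm,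
    fun k hk => (h.shade_eq k hk).symm⟩

theorem GraphMap.AgreeOn.trans {n : ℕ} {I : Set (Fin n)} {a b c : GraphMap n}
    (h : AgreeOn I a b) (h' : AgreeOn I b c) : AgreeOn I a c :=
  ⟨fun i hi j hj => (h.eq_iff i hi j hj).trans (h'.eq_iff i hi j hj),
    fun i hi j hj => (h.edge_eq i hi j hj).trans (h'.edge_eq i hi j hj),
    fun k hk => (h.shade_eq k hk).trans (h'.shade_eq k hk)⟩

theorem GraphMap.AgreeOn.mono {n : ℕ} {I I' : Set (Fin n)} {a b : GraphMap n} (hI : I' ⊆ I)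
    (h : AgreeOn I a b) : AgreeOn I' a b :=
  ⟨fun i hi j hj => h.eq_iff i (hI hi) j (hI hj), fun i hi j hj => h.edge_eq i (hI hi) j (hI hj),
    fun k hk => h.shade_eq k (fun p => hI (hk p))⟩

/-- `a ∼ b`: the two surjections induce the same coloured graph on `n`. -/
instance graphMapSetoid (n : ℕ) : Setoid (GraphMap n) where
  r a b := GraphMap.AgreeOn Set.univ a b
  iseqv := ⟨fun a => GraphMap.AgreeOn.refl _ a, fun h => h.symm, fun h h' => h.trans h'⟩

/-- The rainbow atom structure: the atoms are the classes `[a]`; `[a] T_i [b]` iff `a` and `b`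
induce the same coloured graph on `n ∖ {i}`; `[a] ∈ E_ij` iff `a(i) = a(j)`. -/
def rainbowAtomStructure (n : ℕ) : CylAtomStructure.{0} n where
  Atom := Quotient (graphMapSetoid n)
  rel i := Quotient.lift₂ (fun a b => GraphMap.AgreeOn {i}ᶜ a b) (fun _ _ _ _ h h' =>
    propext ⟨fun k => ((h.mono (Set.subset_univ _)).symm.trans k).trans
        (h'.mono (Set.subset_univ _)),
      fun k => ((h.mono (Set.subset_univ _)).trans k).trans
        (h'.mono (Set.subset_univ _)).symm⟩)
  diag i j := {x | Quotient.lift (fun a : GraphMap n => a.map i = a.map j)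
    (fun _ _ (h : GraphMap.AgreeOn Set.univ _ _) => propext (h.eq_iff i (Set.mem_univ i) j (Set.mem_univ j)))
    x}

/-- The rainbow algebra `C_n`, the complex algebra of the rainbow atom structure. -/
abbrev RainbowAlgebra (n : ℕ) : Type := ComplexAlgebra (rainbowAtomStructure n)

end Rainbow

/-! Fix a black edge $(d_0,d_1)$ and, for integers $t$, apexes $z_t$ joined to $d_0$ by $g_0^t$ and
to $d_1$ by yellow. For $s<t$ the two greens exclude every green and white from $(z_s,z_t)$, the two
yellows exclude yellow and black, and the order condition on reds leaves only $r_{kl}$ with $k<l$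
(`exists_red_of_not_forbidden`). Red triangles have matching indices, so if $(z_{t-1},z_t)$ is red
with first index $k$, then $(z_{t-2},z_{t-1})$ is red with a smaller first index. Apexes with tints
$0,-1,-2,\dots$ would therefore give an infinite descent in $\mathbb N$. They can always be
demanded, because the atoms `cherryAtom hn t` differ only at index 2 (`cherryAtom_rel`). Only three
apexes are needed at a time.

Each of the three claims runs this descent directly. In the game, a face of $n-1$ nodes and three
apex pebbles used in rotation make $n+2$ pebbles. In a complete representation every point lies in
an atom, so each base carries a network (`IsNetwork`) with all apexes present. In a neat embedding
the big algebra need not be atomic, so its nonzero elements replace networks: the apexes sit at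
index 2 and at the two spare dimensions, `move` brings them to indices below $n$, and
`exists_atomElt` finds an atom from which their colours can be read. -/

/-! ### Boolean consequences of complete embeddings. -/

namespace IsCompleteEmbedding

variable {ι A B : Type*} [BooleanAlgebra A] [CylindricOps ι A] [BooleanAlgebra B]
  [CylindricOps ι B] {e : A → B}

theorem map_inf (he : IsCompleteEmbedding ι e) (x y : A) : e (x ⊓ y) = e x ⊓ e y := by
  rw [← compl_inj_iff, ← he.map_compl, compl_inf, he.map_sup, he.map_compl, he.map_compl,
    compl_inf]

theorem map_bot (he : IsCompleteEmbedding ι e) : e ⊥ = ⊥ := by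
  have := he.map_inf ⊥ ⊥ᶜ
  rwa [he.map_compl, inf_compl_self, inf_compl_self] at this

theorem map_top (he : IsCompleteEmbedding ι e) : e ⊤ = ⊤ := by
  rw [← compl_bot, he.map_compl, he.map_bot, compl_bot]

theorem mono (he : IsCompleteEmbedding ι e) {x y : A} (h : x ≤ y) : e x ≤ e y := by
  rw [← sup_eq_right.mpr h, he.map_sup]
  exact le_sup_left

end IsCompleteEmbedding

/-! ### Singletons in complex algebras. -/

namespace Rainbow

/-- An atom, as an element of the complex algebra. -/
def single {n : ℕ} {S : CylAtomStructure.{u} n} (x : S.Atom) : ComplexAlgebra S :=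
  ({x} : Set S.Atom)

/-- The only supremum whose preservation is needed: it forces the images of the atoms to cover the
unit. -/
theorem isLUB_range_single {n : ℕ} (S : CylAtomStructure.{u} n) :
    IsLUB (Set.range (single (S := S))) ⊤ := by
  refine ⟨fun _ _ => le_top, fun Y hY x _ => ?_⟩
  exact hY ⟨x, rfl⟩ (Set.mem_singleton x)

theorem single_inf_eq_bot {n : ℕ} {S : CylAtomStructure.{u} n} {x : S.Atom}
    {X : ComplexAlgebra S} (h : x ∉ (show Set S.Atom from X)) : single x ⊓ X = ⊥ :=
  Set.singleton_inter_eq_empty.mpr h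

theorem single_ne_bot {n : ℕ} {S : CylAtomStructure.{u} n} (x : S.Atom) : single x ≠ ⊥ :=
  Set.singleton_ne_empty x

theorem single_le_cyl_single {n : ℕ} {S : CylAtomStructure.{u} n} {i : Fin n} {x y : S.Atom} :
    single x ≤ CylindricOps.cyl i (single y) ↔ S.rel i x y := by
  constructor
  · intro h
    obtain ⟨b, rfl, hb⟩ := h (Set.mem_singleton x)
    exact hb
  · rintro h _ rfl
    exact Set.mem_ofPred.mpr ⟨y, rfl, h⟩

/-! ### The colours of the edges of an atom -/

/-- The colour of the edge `(p, q)` of an atom of the rainbow atom structure. -/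
def edgeColour {n : ℕ} (x : (rainbowAtomStructure n).Atom) (p q : Fin n) :
    Option (EdgeColour n) :=
  Quotient.lift (fun a : GraphMap n => a.graph.edge (a.map p) (a.map q))
    (fun _ _ (h : GraphMap.AgreeOn Set.univ _ _) =>
      h.edge_eq p (Set.mem_univ p) q (Set.mem_univ q)) x

section edgeColour

variable {n : ℕ} {x y : (rainbowAtomStructure n).Atom} {i p q r : Fin n}

theorem edgeColour_eq_of_rel (h : (rainbowAtomStructure n).rel i x y) (hp : p ≠ i) (hq : q ≠ i) :
    edgeColour x p q = edgeColour y p q := by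
  induction x using Quotient.inductionOn with | _ a
  induction y using Quotient.inductionOn with | _ b
  exact GraphMap.AgreeOn.edge_eq (I := {i}ᶜ) h p hp q hq

theorem edgeColour_left_of_diag (h : x ∈ (rainbowAtomStructure n).diag p q) (r : Fin n) :
    edgeColour x p r = edgeColour x q r := by
  induction x using Quotient.inductionOn with | _ a
  have h' : a.map p = a.map q := h
  change a.graph.edge (a.map p) _ = a.graph.edge (a.map q) _
  rw [h']

theorem edgeColour_right_of_diag (h : x ∈ (rainbowAtomStructure n).diag p q) (r : Fin n) :
    edgeColour x r p = edgeColour x r q := by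
  induction x using Quotient.inductionOn with | _ a
  have h' : a.map p = a.map q := h
  change a.graph.edge _ (a.map p) = a.graph.edge _ (a.map q)
  rw [h']

theorem edgeColour_of_diag (h : x ∈ (rainbowAtomStructure n).diag p q) :
    edgeColour x p q = none := by
  induction x using Quotient.inductionOn with | _ a
  have h' : a.map p = a.map q := h
  change a.graph.edge (a.map p) _ = none
  rw [h', a.graph.edge_self]

/-- Graphs in $\mathbf J$ are complete, so only equal nodes lack a colour. -/
theorem mem_diag_of_edgeColour (h : edgeColour x p q = none) :
    x ∈ (rainbowAtomStructure n).diag p q := by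
  induction x using Quotient.inductionOn with | _ a
  by_contra hne
  exact a.inJ.complete (a.map p) (a.map q) hne h

theorem edgeColour_symm (x : (rainbowAtomStructure n).Atom) (p q : Fin n) :
    edgeColour x q p = (edgeColour x p q).map EdgeColour.conv := by
  induction x using Quotient.inductionOn with | _ a
  exact a.graph.edge_symm _ _

theorem not_forbidden_edgeColour {c c' c'' : EdgeColour n} (h : edgeColour x p q = some c)
    (h' : edgeColour x p r = some c') (h'' : edgeColour x q r = some c'') :
    ¬ Forbidden c c' c'' := by
  induction x using Quotient.inductionOn with | _ a
  exact a.inJ.no_forbidden _ _ _ _ _ _ h h' h''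

end edgeColour

/-- An edge that sees two greens `g_0^s`, `g_0^t` and two yellows is red. -/
theorem exists_red_of_not_forbidden {n : ℕ} {s t : ℤ} (hst : s < t) {c : EdgeColour n}
    (hg : ¬ Forbidden (.greenZero s) (.greenZero t) c) (hy : ¬ Forbidden .yellow .yellow c) :
    ∃ k l, k < l ∧ c = .red k l := by
  cases c with
  | green i h => exact (hg (.greens (.greenZero _) (.greenZero _) (.green i h))).elim
  | greenZero r => exact (hg (.greens (.greenZero _) (.greenZero _) (.greenZero r))).elim
  | white => exact (hg (.greenZeroWhite _ _ .white)).elim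
  | whiteFun f => exact (hg (.greenZeroWhite _ _ (.whiteFun f))).elim
  | yellow => exact (hy .yellows).elim
  | black => exact (hy .yellowBlack).elim
  | red k l =>
    refine ⟨k, l, ?_, rfl⟩
    by_contra hkl
    exact hg (.redGreen s t k l fun h => hkl (h.2.1 hst))

/-! ### The atoms `cherryAtom t` -/

/-- The edges of the triangle on `0, 1, 2` with colours black, `g_0^t` and yellow. -/
def cherryEdge (n : ℕ) (t : ℤ) : ℕ → ℕ → Option (EdgeColour n)
  | 0, 1 => some .black
  | 1, 0 => some .black
  | 0, 2 => some (.greenZero t)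
  | 2, 0 => some (.greenZero t)
  | 1, 2 => some .yellow
  | 2, 1 => some .yellow
  | _, _ => none

/-- The pairs of nodes of the triangle whose edge is green. -/
def CherryGreen (x y : ℕ) : Prop := x = 0 ∧ y = 2 ∨ x = 2 ∧ y = 0

theorem cherryEdge_self (n : ℕ) (t : ℤ) (x : ℕ) : cherryEdge n t x x = none := by
  rcases x with _ | _ | _ | x <;> rfl

theorem cherryEdge_symm (n : ℕ) (t : ℤ) (x y : ℕ) :
    cherryEdge n t y x = (cherryEdge n t x y).map EdgeColour.conv := by
  unfold cherryEdge; split <;> first | rfl | (split <;> first | rfl | (exfalso; simp_all))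

open Classical in
/-- The coloured graph of the triangle with colours black, `g_0^t` and yellow; all shades are
`y_ℤ`. -/
noncomputable def cherryGraph (n : ℕ) (t : ℤ) : ColouredGraph n ({0, 1, 2} : Set ℕ) where
  edge x y := cherryEdge n t x y
  shade d := if Function.Injective d ∧ ∀ p q, ¬ CherryGreen (d p) (d q) then
    some ⟨Set.univ, Or.inr rfl⟩ else none
  edge_self x := cherryEdge_self n t x
  edge_symm x y := cherryEdge_symm n t x y

theorem cherryGraph_greenEdge (n : ℕ) (t : ℤ) (x y : ({0, 1, 2} : Set ℕ)) :
    (cherryGraph n t).GreenEdge x y ↔ CherryGreen x y := by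
  obtain ⟨x, rfl | rfl | rfl⟩ := x <;> obtain ⟨y, rfl | rfl | rfl⟩ := y <;>
    simp [ColouredGraph.GreenEdge, cherryGraph, cherryEdge, CherryGreen] <;>
    first | exact .greenZero t | (intro h; cases h)

/-- The only triangle has one green, one yellow and one black edge, which is not forbidden in any
order; the cone condition holds because every shade is $y_{\mathbb Z}$. -/
theorem cherryGraph_inJ (n : ℕ) (t : ℤ) : (cherryGraph n t).InJ where
  complete x y hxy := by
    obtain ⟨x, rfl | rfl | rfl⟩ := x <;> obtain ⟨y, rfl | rfl | rfl⟩ := y <;>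
      first | exact (hxy rfl).elim | simp [cherryGraph, cherryEdge]
  no_forbidden x y z c c' c'' h h' h'' hf := by
    obtain ⟨x, rfl | rfl | rfl⟩ := x <;> obtain ⟨y, rfl | rfl | rfl⟩ := y <;>
      first
      | exact Option.some_ne_none _ h.symm
      | obtain ⟨z, rfl | rfl | rfl⟩ := z <;>
        first
        | exact Option.some_ne_none _ h'.symm
        | exact Option.some_ne_none _ h''.symm
        | (cases h; cases h'; cases h''; cases hf with
            | greens h1 h2 => cases h1 <;> cases h2)
  shade_iff d := by
    simp only [cherryGraph_greenEdge]
    simp [cherryGraph]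
  cone d z s S _ hS := by
    dsimp only [cherryGraph] at hS
    split_ifs at hS
    cases hS
    trivial

/-- The map of `n` onto `0, 1, 2` that fixes `0` and `2` and takes all other indices to `1`. -/
def cherryMap {n : ℕ} (p : Fin n) : ({0, 1, 2} : Set ℕ) :=
  if p.val = 0 then ⟨0, by simp⟩ else if p.val = 2 then ⟨2, by simp⟩ else ⟨1, by simp⟩

/-- The surjection of `n` onto the triangle with colours black, `g_0^t` and yellow. -/
noncomputable def cherry {n : ℕ} (hn : 3 ≤ n) (t : ℤ) : GraphMap n where
  nodes := {0, 1, 2}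
  graph := cherryGraph n t
  inJ := cherryGraph_inJ n t
  map := cherryMap
  surjective x := by
    obtain ⟨x, rfl | rfl | rfl⟩ := x
    · exact ⟨⟨0, by omega⟩, rfl⟩
    · exact ⟨⟨1, by omega⟩, rfl⟩
    · exact ⟨⟨2, by omega⟩, rfl⟩

/-- The atom of `cherry hn t`. -/
noncomputable def cherryAtom {n : ℕ} (hn : 3 ≤ n) (t : ℤ) : (rainbowAtomStructure n).Atom :=
  Quotient.mk _ (cherry hn t)

theorem cherryEdge_of_ne_two (n : ℕ) (s t : ℤ) {x y : ℕ} (hx : x ≠ 2) (hy : y ≠ 2) :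
    cherryEdge n s x y = cherryEdge n t x y := by
  unfold cherryEdge; split <;> simp_all

theorem cherryMap_ne_two {n : ℕ} {p : Fin n} (hp : p.val ≠ 2) :
    (cherryMap p : ℕ) ≠ 2 := by
  unfold cherryMap; split_ifs <;> simp

section cherryAtom

variable {n : ℕ} (hn : 3 ≤ n)

/-- Only the edge into node 2 carries the tint, and index 2 alone is mapped there; the shades do not
depend on the tint. -/
theorem cherryAtom_rel (s t : ℤ) :
    (rainbowAtomStructure n).rel ⟨2, hn⟩ (cherryAtom hn s) (cherryAtom hn t) := by
  change GraphMap.AgreeOn {⟨2, hn⟩}ᶜ (cherry hn s) (cherry hn t)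
  refine ⟨fun _ _ _ _ => Iff.rfl, fun i hi j hj => ?_, fun _ _ => rfl⟩
  exact cherryEdge_of_ne_two n s t (cherryMap_ne_two fun h => hi (Fin.ext h))
    (cherryMap_ne_two fun h => hj (Fin.ext h))

theorem edgeColour_cherryAtom_green (t : ℤ) :
    edgeColour (cherryAtom hn t) ⟨0, by omega⟩ ⟨2, hn⟩ = some (.greenZero t) := rfl

theorem edgeColour_cherryAtom_yellow (t : ℤ) :
    edgeColour (cherryAtom hn t) ⟨1, by omega⟩ ⟨2, hn⟩ = some .yellow := rfl

/-- Shows that the first apex is not on the face, so that its pebble may be reused. -/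
theorem edgeColour_cherryAtom_ne_none (t : ℤ) {p : Fin n} (hp : p ≠ ⟨2, hn⟩) :
    edgeColour (cherryAtom hn t) p ⟨2, hn⟩ ≠ none := by
  have h2 : p.val ≠ 2 := fun h => hp (Fin.ext h)
  change cherryEdge n t (cherryMap p) 2 ≠ none
  unfold cherryMap
  split_ifs <;> simp [cherryEdge]

end cherryAtom

end Rainbow

namespace Rainbow

/-! ### Networks -/

/-- `L` labels the tuples of elements of `X` by atoms as an atomic network does. -/
structure IsNetwork {n : ℕ} {U : Type*} (X : Set U)
    (L : (Fin n → U) → (rainbowAtomStructure n).Atom) : Prop where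
  label_diag : ∀ (i j : Fin n) (δ : Fin n → U), (∀ p, δ p ∈ X) →
    L (Function.update δ j (δ i)) ∈ (rainbowAtomStructure n).diag i j
  label_cyl : ∀ (i : Fin n) (δ : Fin n → U) (d : U), (∀ p, δ p ∈ X) → d ∈ X →
    (rainbowAtomStructure n).rel i (L (Function.update δ i d)) (L δ)

namespace IsNetwork

variable {n : ℕ} {U : Type*} {X : Set U} {L : (Fin n → U) → (rainbowAtomStructure n).Atom}

theorem mem_diag (h : IsNetwork X L) {δ : Fin n → U} (hδ : ∀ p, δ p ∈ X) {i j : Fin n}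
    (hij : δ i = δ j) : L δ ∈ (rainbowAtomStructure n).diag i j := by
  have := h.label_diag i j δ hδ
  rwa [hij, Function.update_eq_self] at this

theorem edgeColour_congr (h : IsNetwork X L) {δ ε : Fin n → U} (hδ : ∀ p, δ p ∈ X)
    (hε : ∀ p, ε p ∈ X) {i j : Fin n} (hi : δ i = ε i) (hj : δ j = ε j) :
    edgeColour (L δ) i j = edgeColour (L ε) i j := by
  classical
  -- The coordinates are replaced one at a time: a change at $a\notin\{i,j\}$ is a $T_a$ step, and
  -- at $i$ and $j$ nothing changes.
  have key : ∀ s : Finset (Fin n),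
      edgeColour (L (s.piecewise ε δ)) i j = edgeColour (L δ) i j := by
    intro s
    induction s using Finset.induction_on with
    | empty => simp
    | insert a s _ ih =>
      rw [← ih, Finset.piecewise_insert]
      have hmem : ∀ p, s.piecewise ε δ p ∈ X := fun p => by
        by_cases hp : p ∈ s <;> simp [hp, hδ, hε]
      by_cases ha : a = i ∨ a = j
      · have : s.piecewise ε δ a = ε a := by
          by_cases has : a ∈ s
          · simp [has]
          · rcases ha with rfl | rfl <;> simp [has, hi, hj]
        rw [← this, Function.update_eq_self]
      · push Not at ha
        exact edgeColour_eq_of_rel (h.label_cyl a _ _ hmem (hε a)) ha.1.symm ha.2.symm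
  simpa using (key Finset.univ).symm

theorem edgeColour_left (h : IsNetwork X L) {δ : Fin n → U} (hδ : ∀ p, δ p ∈ X)
    {i i' j : Fin n} (hi' : i' ≠ j) :
    edgeColour (L (Function.update δ i' (δ i))) i' j = edgeColour (L δ) i j := by
  have hm : ∀ p, Function.update δ i' (δ i) p ∈ X := fun p => by
    by_cases hp : p = i'
    · subst hp; simpa using hδ i
    · simpa [hp] using hδ p
  have hd : Function.update δ i' (δ i) i = δ i := by
    by_cases hp : i = i'
    · subst hp; simp
    · simp [hp]
  rw [← edgeColour_left_of_diag (h.mem_diag hm (i := i) (j := i') (by simp [hd])) j]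
  exact h.edgeColour_congr hm hδ hd (by simp [hi'.symm])

/-- The colours of edges do not depend on the tuples and indices used to read them. -/
theorem edgeColour_eq (h : IsNetwork X L) (hn : 3 ≤ n) {δ ε : Fin n → U} (hδ : ∀ p, δ p ∈ X)
    (hε : ∀ p, ε p ∈ X) {i j k l : Fin n} (hij : i ≠ j) (hkl : k ≠ l) (hi : δ i = ε k)
    (hj : δ j = ε l) : edgeColour (L δ) i j = edgeColour (L ε) k l := by
  have left : ∀ {δ ε : Fin n → U} {i j k : Fin n}, (∀ p, δ p ∈ X) → (∀ p, ε p ∈ X) → i ≠ j →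
      k ≠ j → δ i = ε k → δ j = ε j → edgeColour (L δ) i j = edgeColour (L ε) k j := by
    intro δ ε i j k hδ hε hij hkj hi hj
    rw [← h.edgeColour_left hδ hkj]
    refine h.edgeColour_congr (fun p => ?_) hε (by simp [hi]) (by simp [hkj.symm, hj])
    by_cases hp : p = k
    · subst hp; simpa using hδ i
    · simpa [hp] using hδ p
  have right : ∀ {δ ε : Fin n → U} {i j k : Fin n}, (∀ p, δ p ∈ X) → (∀ p, ε p ∈ X) → i ≠ j →
      k ≠ j → δ i = ε k → δ j = ε j → edgeColour (L δ) j i = edgeColour (L ε) j k := by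
    intro δ ε i j k hδ hε hij hkj hi hj
    rw [edgeColour_symm, edgeColour_symm (L ε), left hδ hε hij hkj hi hj]
  have upd : ∀ {δ : Fin n → U} {m m' : Fin n}, (∀ p, δ p ∈ X) →
      ∀ p, Function.update δ m (δ m') p ∈ X := by
    intro δ m m' hδ p
    by_cases hp : p = m
    · subst hp; simpa using hδ m'
    · simpa [hp] using hδ p
  -- Writing at index `k` would overwrite the second endpoint when `k = j`; a third index `m`,
  -- available as $n\ge3$, then serves as temporary storage.
  by_cases hkj : k = j
  · obtain ⟨m, hm⟩ : ∃ m : Fin n, m ≠ i ∧ m ≠ j := by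
      have : ∃ m ∉ ({i, j} : Finset (Fin n)), True := by
        by_contra! hc
        have := Finset.card_le_card (show (Finset.univ : Finset (Fin n)) ⊆ {i, j} from
          fun m _ => by by_contra hm; exact hc m hm)
        have h2 := Finset.card_le_two (a := i) (b := j)
        rw [Finset.card_univ, Fintype.card_fin] at this
        omega
      simpa using this
    subst hkj
    -- `(i, k) → (i, m) → (k, m) → (k, l)`
    have e1 := right (i := k) (j := i) (k := m) hδ (upd (m := m) (m' := k) hδ) hij.symm hm.1
      (by simp) (by simp [hm.1.symm])
    have e2 := left (i := i) (j := m) (k := k) (upd (m := m) (m' := k) hδ)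
      (upd (m := k) (m' := i) (upd (m := m) (m' := k) hδ)) hm.1.symm hm.2.symm (by simp)
      (by simp [hm.2])
    rw [e1, e2]
    refine right (upd (upd hδ)) hε hm.2 hkl.symm ?_ ?_
    · simp [hm.2, hj]
    · simp [hm.1.symm, hi]
  · have hu := upd (m := k) (m' := i) hδ
    rw [left hδ hu hij hkj (by simp) (by simp [Ne.symm hkj])]
    exact right hu hε (Ne.symm hkj) hkl.symm (by simp [Ne.symm hkj, hj]) (by simp [hi])

/-- The edge between two elements has the given colour. -/
def Coloured (X : Set U) (L : (Fin n → U) → (rainbowAtomStructure n).Atom) (x y : U)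
    (c : EdgeColour n) : Prop :=
  ∀ (δ : Fin n → U) (i j : Fin n), (∀ p, δ p ∈ X) → i ≠ j → δ i = x → δ j = y →
    edgeColour (L δ) i j = some c

theorem coloured (h : IsNetwork X L) (hn : 3 ≤ n) {δ : Fin n → U} (hδ : ∀ p, δ p ∈ X)
    {i j : Fin n} (hij : i ≠ j) {c : EdgeColour n} (hc : edgeColour (L δ) i j = some c) :
    Coloured X L (δ i) (δ j) c := fun ε k l hε hkl hk hl => by
  rw [← hc]
  exact h.edgeColour_eq hn hε hδ hkl hij hk hl

theorem Coloured.not_forbidden (hn : 3 ≤ n) {x y z : U} (hx : x ∈ X) (hy : y ∈ X)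
    (hz : z ∈ X) {c c' c'' : EdgeColour n} (h : Coloured X L x y c) (h' : Coloured X L x z c')
    (h'' : Coloured X L y z c'') : ¬ Forbidden c c' c'' := by
  let δ : Fin n → U := fun p => if p.val = 0 then x else if p.val = 1 then y else z
  have hδ : ∀ p, δ p ∈ X := fun p => by simp only [δ]; split_ifs <;> assumption
  exact not_forbidden_edgeColour (h δ ⟨0, by omega⟩ ⟨1, by omega⟩ hδ (by simp) rfl rfl)
    (h' δ ⟨0, by omega⟩ ⟨2, by omega⟩ hδ (by simp) rfl rfl)
    (h'' δ ⟨1, by omega⟩ ⟨2, by omega⟩ hδ (by simp) rfl rfl)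

theorem update_mem {δ : Fin n → U} (hδ : ∀ p, δ p ∈ X) {i : Fin n} {z : U} (hz : z ∈ X)
    (p : Fin n) : Function.update δ i z p ∈ X := by
  by_cases hp : p = i
  · subst hp; simpa using hz
  · simpa [hp] using hδ p

theorem coloured_of_cherry (h : IsNetwork X L) (hn : 3 ≤ n) {δ : Fin n → U}
    (hδ : ∀ p, δ p ∈ X) {z : U} (hz : z ∈ X) {t : ℤ}
    (ht : L (Function.update δ ⟨2, hn⟩ z) = cherryAtom hn t) :
    Coloured X L (δ ⟨0, by omega⟩) z (.greenZero t) ∧ Coloured X L (δ ⟨1, by omega⟩) z .yellow := by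
  constructor
  · have := h.coloured hn (update_mem hδ hz) (i := ⟨0, by omega⟩) (j := ⟨2, hn⟩) (by simp)
      (by rw [ht]; exact edgeColour_cherryAtom_green hn t)
    rwa [Function.update_self, Function.update_of_ne (by simp)] at this
  · have := h.coloured hn (update_mem hδ hz) (i := ⟨1, by omega⟩) (j := ⟨2, hn⟩) (by simp)
      (by rw [ht]; exact edgeColour_cherryAtom_yellow hn t)
    rwa [Function.update_self, Function.update_of_ne (by simp)] at this

/-- The edge between the apexes of two triangles on the same black edge is red. -/
theorem exists_red (h : IsNetwork X L) (hn : 3 ≤ n) {δ : Fin n → U} (hδ : ∀ p, δ p ∈ X)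
    {z z' : U} (hz : z ∈ X) (hz' : z' ∈ X) {s t : ℤ} (hst : s < t)
    (hs : L (Function.update δ ⟨2, hn⟩ z) = cherryAtom hn s)
    (ht : L (Function.update δ ⟨2, hn⟩ z') = cherryAtom hn t) :
    ∃ k l, k < l ∧ Coloured X L z z' (.red k l) := by
  obtain ⟨hg, hy⟩ := h.coloured_of_cherry hn hδ hz hs
  obtain ⟨hg', hy'⟩ := h.coloured_of_cherry hn hδ hz' ht
  -- Both apexes and the green end of the base are put into one tuple, so that a single atom shows
  -- the edge between the apexes.
  let ε : Fin n → U :=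
    fun p => if p.val = 0 then δ ⟨0, by omega⟩ else if p.val = 1 then z else z'
  have hε : ∀ p, ε p ∈ X := fun p => by
    simp only [ε]; split_ifs <;> first | assumption | exact hδ _
  have h01 := hg ε ⟨0, by omega⟩ ⟨1, by omega⟩ hε (by simp) rfl rfl
  have h02 := hg' ε ⟨0, by omega⟩ ⟨2, by omega⟩ hε (by simp) rfl rfl
  cases hc : edgeColour (L ε) ⟨1, by omega⟩ ⟨2, hn⟩ with
  -- Without a colour the apexes would be identified in the label, and the two tints would coincide.
  | none =>
    have := edgeColour_right_of_diag (mem_diag_of_edgeColour hc) ⟨0, by omega⟩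
    rw [h01, h02] at this
    cases this
    exact (lt_irrefl _ hst).elim
  | some c =>
    have hcol : Coloured X L z z' c := h.coloured hn hε (by simp) hc
    obtain ⟨k, l, hkl, rfl⟩ := exists_red_of_not_forbidden hst
      (hg.not_forbidden hn (hδ _) hz hz' hg' hcol) (hy.not_forbidden hn (hδ _) hz hz' hy' hcol)
    exact ⟨k, l, hkl, hcol⟩

/-- Three elements joined by red edges have consistent indices. -/
theorem red_eq (h : IsNetwork X L) (hn : 3 ≤ n) {δ : Fin n → U} (hδ : ∀ p, δ p ∈ X)
    {x y z : U} (hx : x ∈ X) (hy : y ∈ X) (hz : z ∈ X) {r s t : ℤ} (hrs : r < s) (hst : s < t)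
    (hr : L (Function.update δ ⟨2, hn⟩ x) = cherryAtom hn r)
    (hs : L (Function.update δ ⟨2, hn⟩ y) = cherryAtom hn s)
    (ht : L (Function.update δ ⟨2, hn⟩ z) = cherryAtom hn t) {k l : ℕ}
    (hyz : Coloured X L y z (.red k l)) : ∃ m < k, Coloured X L x y (.red m k) := by
  obtain ⟨m, k', hm, hxy⟩ := h.exists_red hn hδ hx hy hrs hr hs
  obtain ⟨m', l', hm', hxz⟩ := h.exists_red hn hδ hx hz (hrs.trans hst) hr ht
  have hk : k' = k := by
    by_contra hne
    exact hxy.not_forbidden hn hx hy hz hxz hyz (.reds _ _ _ _ _ _ fun h => hne h.2.1)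
  subst hk
  exact ⟨m, hm, hxy⟩

end IsNetwork

/-! ### Complete representations -/

theorem not_isCompletelyRepresentable {n : ℕ} (hn : 3 ≤ n) :
    ¬ IsCompletelyRepresentable.{0, v} n (RainbowAlgebra n) := by
  rintro ⟨I, U, W, hW, e, he⟩
  let V := genCartesianSpace n W
  have hatom : ∀ s : V, ∃ x : (rainbowAtomStructure n).Atom,
      s ∈ (show Set V from e (single x)) := by
    intro s
    have hlub := he.map_isLUB _ _ (isLUB_range_single (rainbowAtomStructure n))
    rw [he.map_top] at hlub
    by_contra! hc
    -- A point outside all images of atoms would leave its complement as an upper bound smaller than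
    -- the unit.
    have hle : (⊤ : FullSetAlgebra V) ≤ (show FullSetAlgebra V from ({s}ᶜ : Set V)) := by
      refine hlub.2 ?_
      rintro _ ⟨_, ⟨x, rfl⟩, rfl⟩ r hr hrs
      exact hc x (hrs ▸ hr)
    exact hle (Set.mem_univ s) rfl
  choose lab hlab using hatom
  have hmem : ∀ (s : V) (X : RainbowAlgebra n), s ∈ (show Set V from e X) →
      lab s ∈ (show Set (rainbowAtomStructure n).Atom from X) := by
    intro s X hs
    by_contra hc
    have h1 : s ∈ (show Set V from e (single (lab s) ⊓ X)) := by
      rw [he.map_inf]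
      exact ⟨hlab s, hs⟩
    rw [single_inf_eq_bot hc, he.map_bot] at h1
    exact h1
  obtain ⟨s₀, hs₀⟩ : ∃ s : V, s ∈ (show Set V from e (single (cherryAtom hn 0))) := by
    by_contra! hc
    have hbot : e (single (cherryAtom hn 0)) = e ⊥ := by
      rw [he.map_bot]
      exact Set.eq_empty_of_forall_notMem hc
    exact single_ne_bot _ (he.injective hbot)
  obtain ⟨T, hT⟩ := s₀.2
  classical
  let L : (Fin n → U) → (rainbowAtomStructure n).Atom :=
    fun δ => if h : δ ∈ V then lab ⟨δ, h⟩ else cherryAtom hn 0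
  have hL : ∀ δ (h : δ ∈ V), L δ = lab ⟨δ, h⟩ := fun δ h => dif_pos h
  have hV : ∀ δ : Fin n → U, (∀ p, δ p ∈ W T) → δ ∈ V := fun δ h => ⟨T, h⟩
  have hnet : IsNetwork (W T) L := by
    constructor
    · intro i j δ hδ
      have hu : Function.update δ j (δ i) ∈ V := hV _ (IsNetwork.update_mem hδ (hδ i))
      rw [hL _ hu]
      apply hmem ⟨_, hu⟩ (CylindricOps.diag i j : RainbowAlgebra n)
      rw [he.map_diag]
      change Function.update δ j (δ i) i = Function.update δ j (δ i) j
      by_cases hij : i = j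
      · rw [hij]
      · simp [hij]
    · intro i δ d hδ hd
      have hu : Function.update δ i d ∈ V := hV _ (IsNetwork.update_mem hδ hd)
      rw [hL _ hu, hL _ (hV _ hδ)]
      obtain ⟨b, hb, hrel⟩ := hmem ⟨_, hu⟩
        (CylindricOps.cyl i (single (lab ⟨δ, hV _ hδ⟩)) : RainbowAlgebra n) (by
          rw [he.map_cyl]
          exact ⟨⟨δ, hV _ hδ⟩, hlab _, fun j hj => by simp [hj]⟩)
      cases hb
      exact hrel
  have hapex : ∀ t : ℤ, ∃ z ∈ W T,
      L (Function.update s₀.1 ⟨2, hn⟩ z) = cherryAtom hn t := by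
    intro t
    have hle : single (cherryAtom hn 0) ≤
        CylindricOps.cyl (⟨2, hn⟩ : Fin n) (single (cherryAtom hn t) : RainbowAlgebra n) :=
      single_le_cyl_single.mpr (cherryAtom_rel hn 0 t)
    have hs : s₀ ∈ (show Set V from
        e (CylindricOps.cyl (⟨2, hn⟩ : Fin n) (single (cherryAtom hn t)))) := by
      rw [← sup_eq_right.mpr hle, he.map_sup]
      exact Or.inl hs₀
    rw [he.map_cyl] at hs
    obtain ⟨r, hr, hrs⟩ := hs
    obtain ⟨T', hT'⟩ := r.2
    -- The witness shares coordinate 0 with `s₀`, and the bases are disjoint, so the new apex lies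
    -- in the same base.
    have hTT : T' = T := by
      by_contra hne
      refine Set.disjoint_left.mp (hW hne) (hT' ⟨0, by omega⟩) ?_
      rw [hrs _ (by simp)]
      exact hT _
    subst hTT
    refine ⟨r.1 ⟨2, hn⟩, hT' _, ?_⟩
    have hu : Function.update s₀.1 ⟨2, hn⟩ (r.1 ⟨2, hn⟩) = r.1 := by
      ext p
      by_cases hp : p = ⟨2, hn⟩
      · subst hp; simp
      · simp [hp, hrs p hp]
    rw [hu, hL _ r.2]
    exact hmem r _ hr
  choose z hzW hz using hapex
  -- Strong induction on the first red index: passing to the apex with tint `t - 2` lowers it.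
  have hdesc : ∀ k : ℕ, ∀ (t : ℤ) (l : ℕ),
      ¬ IsNetwork.Coloured (W T) L (z (t - 1)) (z t) (.red k l) := by
    intro k
    induction k using Nat.strong_induction_on with
    | _ k ih =>
      intro t l hcol
      obtain ⟨m, hm, hcol'⟩ := hnet.red_eq hn hT (hzW (t - 1 - 1)) (hzW (t - 1)) (hzW t)
        (by omega) (by omega) (hz _) (hz _) (hz _) hcol
      exact ih m hm (t - 1) k hcol'
  obtain ⟨k, l, _, hcol⟩ := hnet.exists_red hn hT (hzW (0 - 1)) (hzW 0) (by omega) (hz _) (hz _)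
  exact hdesc k 0 l hcol

end Rainbow

namespace Rainbow

/-! ### The game -/

section game

variable {n : ℕ}

/-- The atom of the atom structure of the complex algebra given by an atom of the structure. -/
def toAtom {S : CylAtomStructure.{u} n} (x : S.Atom) :
    (atomStructure n (ComplexAlgebra S)).Atom :=
  ⟨single x, Set.isAtom_singleton x⟩

theorem exists_eq_toAtom {S : CylAtomStructure.{u} n}
    (a : (atomStructure n (ComplexAlgebra S)).Atom) : ∃ x : S.Atom, a = toAtom x := by
  obtain ⟨x, hx⟩ := Set.isAtom_iff.mp a.2
  exact ⟨x, Subtype.ext hx⟩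

theorem toAtom_injective {S : CylAtomStructure.{u} n} :
    Function.Injective (toAtom (S := S)) := fun x y h => by
  have h' : ({x} : Set S.Atom) = {y} := congrArg Subtype.val h
  exact Set.singleton_eq_singleton_iff.mp h'

theorem rel_toAtom {S : CylAtomStructure.{u} n} {i : Fin n} {x y : S.Atom} :
    (atomStructure n (ComplexAlgebra S)).rel i (toAtom x) (toAtom y) ↔ S.rel i x y :=
  single_le_cyl_single

theorem toAtom_mem_diag {S : CylAtomStructure.{u} n} {i j : Fin n} {x : S.Atom} :
    toAtom x ∈ (atomStructure n (ComplexAlgebra S)).diag i j ↔ x ∈ S.diag i j :=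
  Set.singleton_subset_iff

/-- The atom of the rainbow atom structure that labels a tuple. -/
noncomputable def rainbowLabel (N : AtomicNetwork (atomStructure n (RainbowAlgebra n)))
    (δ : Fin n → ℕ) : (rainbowAtomStructure n).Atom :=
  (exists_eq_toAtom (N.label δ)).choose

theorem toAtom_rainbowLabel (N : AtomicNetwork (atomStructure n (RainbowAlgebra n)))
    (δ : Fin n → ℕ) : toAtom (rainbowLabel N δ) = N.label δ :=
  (exists_eq_toAtom (N.label δ)).choose_spec.symm

theorem rainbowLabel_eq {N : AtomicNetwork (atomStructure n (RainbowAlgebra n))}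
    {δ : Fin n → ℕ} {x : (rainbowAtomStructure n).Atom} (h : N.label δ = toAtom x) :
    rainbowLabel N δ = x :=
  toAtom_injective ((toAtom_rainbowLabel N δ).trans h)

theorem isNetwork_rainbowLabel (N : AtomicNetwork (atomStructure n (RainbowAlgebra n))) :
    IsNetwork (N.nodes : Set ℕ) (rainbowLabel N) where
  label_diag i j δ hδ := by
    rw [← toAtom_mem_diag, toAtom_rainbowLabel]
    exact N.label_diag i j δ hδ
  label_cyl i δ d hδ hd := by
    rw [← rel_toAtom, toAtom_rainbowLabel, toAtom_rainbowLabel]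
    exact N.label_cyl i δ d hδ hd

/-- The sequence of pebbles avoids the face, and any three consecutive ones are distinct. -/
structure IsPebbling (n m : ℕ) (l : Fin n) (d : Fin n → ℕ) (k : ℕ → ℕ) : Prop where
  zero : k 0 = d l
  lt : ∀ r, k (r + 1) < m
  ne_face : ∀ r p, p ≠ l → k (r + 1) ≠ d p
  ne_one : ∀ r, k (r + 1) ≠ k r
  ne_two : ∀ r, k (r + 2) ≠ k r

theorem exists_isPebbling {l : Fin n} {d : Fin n → ℕ} (hd : ∀ p, d p < n + 2)
    (hl : ∀ p, p ≠ l → d l ≠ d p) : ∃ k, IsPebbling n (n + 2) l d k := by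
  classical
  have fresh : ∀ s : Finset ℕ, s.card < n + 2 → ∃ a < n + 2, a ∉ s := by
    intro s hs
    obtain ⟨a, ha, has⟩ := Finset.exists_mem_notMem_of_card_lt_card
      (hs.trans_eq (Finset.card_range (n + 2)).symm)
    exact ⟨a, Finset.mem_range.mp ha, has⟩
  have hcard : (Finset.univ.image d).card ≤ n :=
    Finset.card_image_le.trans_eq (by simp)
  obtain ⟨a, ha, had⟩ := fresh (Finset.univ.image d) (by omega)
  obtain ⟨b, hb, hbd⟩ := fresh (insert a (Finset.univ.image d))
    ((Finset.card_insert_le _ _).trans_lt (by omega))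
  simp only [Finset.mem_image, Finset.mem_univ, true_and, not_exists, Finset.mem_insert,
    not_or] at had hbd
  have h1 := had l
  have h2 := hbd.2 l
  have h3 := hbd.1
  -- Period 3 keeps the last three apexes distinct; the original apex node and two fresh pebbles
  -- suffice.
  let k : ℕ → ℕ := fun r => if r % 3 = 0 then d l else if r % 3 = 1 then a else b
  refine ⟨k, rfl, fun r => ?_, fun r p hp => ?_, fun r => ?_, fun r => ?_⟩
  · simp only [k]; split_ifs <;> first | assumption | exact hd l
  · simp only [k]
    split_ifs
    · exact hl p hp
    · exact fun h => had p h.symm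
    · exact fun h => hbd.2 p h.symm
  all_goals
    simp only [k]
    have : r % 3 = 0 ∨ r % 3 = 1 ∨ r % 3 = 2 := by omega
    rcases this with h | h | h <;> simp [Nat.add_mod, h] <;> omega

/-- The network without nodes. -/
noncomputable def emptyNetwork (hn : 3 ≤ n) :
    AtomicNetwork (atomStructure n (RainbowAlgebra n)) where
  nodes := ∅
  label _ := toAtom (cherryAtom hn 0)
  label_diag _ _ _ h := absurd (h ⟨0, by omega⟩) (Finset.notMem_empty _)
  label_cyl _ _ _ h := absurd (h ⟨0, by omega⟩) (Finset.notMem_empty _)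

open Classical in
/-- A tuple of nodes of `N` labelled by `cherryAtom hn 0`, if there is one. -/
noncomputable def cherryTuple (hn : 3 ≤ n)
    (N : AtomicNetwork (atomStructure n (RainbowAlgebra n))) : Fin n → ℕ :=
  if h : ∃ d : Fin n → ℕ, (∀ p, d p ∈ N.nodes) ∧ N.label d = toAtom (cherryAtom hn 0) then
    h.choose else 0

open Classical in
/-- A sequence of pebbles for the tuple `d`, if there is one. -/
noncomputable def pebble (l : Fin n) (d : Fin n → ℕ) : ℕ → ℕ :=
  if h : ∃ k, IsPebbling n (n + 2) l d k then h.choose else 0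

/-- The strategy that demands apexes over the same base, with the tints `0, -1, -2, …`. -/
noncomputable def descendingStrategy (hn : 3 ≤ n) :
    ForallStrategy (atomStructure n (RainbowAlgebra n)) where
  init := toAtom (cherryAtom hn 0)
  move Ns :=
    let d := cherryTuple hn (Ns.headD (emptyNetwork hn))
    let k := pebble ⟨2, hn⟩ d
    { N := Ns.getLastD (emptyNetwork hn)
      l := ⟨2, hn⟩
      -- The latest apex fills the disregarded entry: its tuple over the face has a known label,
      -- which makes the demand legal.
      δ := Function.update d ⟨2, hn⟩ (k (Ns.length - 1))
      k := k Ns.length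
      b := toAtom (cherryAtom hn (-(Ns.length : ℤ))) }

/-- The play up to round `r` against `descendingStrategy`: the networks contain the face and the
latest apexes. -/
structure Descends (hn : 3 ≤ n) (d : Fin n → ℕ) (k : ℕ → ℕ)
    (N : ℕ → AtomicNetwork (atomStructure n (RainbowAlgebra n))) (r : ℕ) : Prop where
  face_mem : ∀ p, p ≠ ⟨2, hn⟩ → d p ∈ (N r).nodes
  apex_mem : ∀ s ≤ r, k s ∈ (N r).nodes
  label : ∀ s ≤ r, r ≤ s + 2 →
    rainbowLabel (N r) (Function.update d ⟨2, hn⟩ (k s)) = cherryAtom hn (-(s : ℤ))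

theorem cherryTuple_spec {hn : 3 ≤ n} {N : AtomicNetwork (atomStructure n (RainbowAlgebra n))}
    {m : ℕ} (h : InitialResponse m (toAtom (cherryAtom hn 0)) N) :
    (∀ p, cherryTuple hn N p ∈ N.nodes) ∧
      N.label (cherryTuple hn N) = toAtom (cherryAtom hn 0) := by
  have h' := h.2
  unfold cherryTuple
  rw [dif_pos h']
  exact h'.choose_spec

theorem pebble_spec {hn : 3 ≤ n} {N : AtomicNetwork (atomStructure n (RainbowAlgebra n))}
    (h : InitialResponse (n + 2) (toAtom (cherryAtom hn 0)) N) :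
    IsPebbling n (n + 2) ⟨2, hn⟩ (cherryTuple hn N) (pebble ⟨2, hn⟩ (cherryTuple hn N)) := by
  obtain ⟨hd, hl⟩ := cherryTuple_spec h
  have hex : ∃ k, IsPebbling n (n + 2) ⟨2, hn⟩ (cherryTuple hn N) k := by
    refine exists_isPebbling (fun p => Finset.mem_range.mp (h.1 (hd p))) fun p hp heq => ?_
    have h1 := (isNetwork_rainbowLabel N).mem_diag hd heq.symm
    have h2 := edgeColour_of_diag h1
    rw [rainbowLabel_eq hl] at h2
    exact edgeColour_cherryAtom_ne_none hn 0 hp h2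
  unfold pebble
  rw [dif_pos hex]
  exact hex.choose_spec

/-! ### Plays against the descending strategy. -/

section play

variable {hn : 3 ≤ n} {N : ℕ → AtomicNetwork (atomStructure n (RainbowAlgebra n))}

theorem descendingStrategy_move (r : ℕ) :
    (descendingStrategy hn).move ((List.range (r + 1)).map N) =
      { N := N r
        l := ⟨2, hn⟩
        δ := Function.update (cherryTuple hn (N 0)) ⟨2, hn⟩
          (pebble ⟨2, hn⟩ (cherryTuple hn (N 0)) r)
        k := pebble ⟨2, hn⟩ (cherryTuple hn (N 0)) (r + 1)
        b := toAtom (cherryAtom hn (-((r + 1 : ℕ) : ℤ))) } := by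
  have h0 : ((List.range (r + 1)).map N).headD (emptyNetwork hn) = N 0 := by
    rw [List.range_succ_eq_map]; rfl
  have hl : ((List.range (r + 1)).map N).getLastD (emptyNetwork hn) = N r := by
    rw [List.range_succ, List.map_append]; simp
  simp only [descendingStrategy, h0, hl, List.length_map, List.length_range, Nat.add_sub_cancel]

theorem descends_of_survives {r : ℕ} (h : (descendingStrategy hn).Survives (n + 2) N r) :
    Descends hn (cherryTuple hn (N 0)) (pebble ⟨2, hn⟩ (cherryTuple hn (N 0))) N r := by
  obtain ⟨h0, hs⟩ := h
  have hk := pebble_spec (hn := hn) h0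
  obtain ⟨hd, hl⟩ := cherryTuple_spec (hn := hn) h0
  set d := cherryTuple hn (N 0)
  induction r with
  | zero =>
    refine ⟨fun p _ => hd p, fun s hs => ?_, fun s hs _ => ?_⟩ <;>
      obtain rfl : s = 0 := by omega
    · rw [hk.zero]; exact hd _
    · rw [hk.zero, Function.update_eq_self]; exact rainbowLabel_eq hl
  | succ r ih =>
    have hD := ih fun s hsr => hs s (by omega)
    have hR := hs r (by omega)
    rw [descendingStrategy_move] at hR
    have hnodes := hR.nodes_eq
    dsimp only at hnodes
    refine ⟨fun p hp => ?_, fun s hsr => ?_, fun s hsr hrs => ?_⟩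
    · rw [hnodes]
      exact Finset.mem_insert_of_mem (hD.face_mem p hp)
    · rw [hnodes]
      by_cases hs' : s = r + 1
      · rw [hs']; exact Finset.mem_insert_self _ _
      · exact Finset.mem_insert_of_mem (hD.apex_mem s (by omega))
    · by_cases hs' : s = r + 1
      · subst hs'
        have := hR.label_eq
        rw [Function.update_idem] at this
        exact rainbowLabel_eq this
      -- An older apex within the window of three is not on the pebble being placed, so the label of
      -- its tuple is inherited.
      · rw [← hD.label s (by omega) (by omega)]
        refine rainbowLabel_eq ?_
        rw [toAtom_rainbowLabel]
        refine hR.agree _ fun p => ?_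
        by_cases hp : p = ⟨2, hn⟩
        · subst hp
          rw [Function.update_self]
          refine ⟨hD.apex_mem s (by omega), ?_⟩
          have : s = r ∨ s + 1 = r := by omega
          rcases this with rfl | rfl
          · exact (hk.ne_one s).symm
          · exact (hk.ne_two s).symm
        · rw [Function.update_of_ne hp]
          exact ⟨hD.face_mem p hp, (hk.ne_face r p hp).symm⟩

theorem descendingStrategy_legal {r : ℕ}
    (h : (descendingStrategy hn).Survives (n + 2) N r) :
    ((descendingStrategy hn).move ((List.range (r + 1)).map N)).Legal (n + 2)
      ((List.range (r + 1)).map N) := by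
  have hD := descends_of_survives h
  have hk := pebble_spec (hn := hn) h.1
  rw [descendingStrategy_move]
  refine ⟨List.mem_map.mpr ⟨r, by simp, rfl⟩, fun p => ?_, hk.lt r, fun p hp => ?_, ?_⟩
  · dsimp only
    by_cases hp : p = ⟨2, hn⟩
    · subst hp
      rw [Function.update_self]
      exact hD.apex_mem r le_rfl
    · rw [Function.update_of_ne hp]
      exact hD.face_mem p hp
  · dsimp only
    rw [Function.update_of_ne hp]
    exact hk.ne_face r p hp
  · dsimp only
    rw [← toAtom_rainbowLabel, rel_toAtom, hD.label r le_rfl (by omega)]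
    exact cherryAtom_rel hn _ _

theorem descendingStrategy_wins :
    ∃ r, ¬ (descendingStrategy hn).Survives (n + 2) N r := by
  by_contra! hsur
  set d := cherryTuple hn (N 0) with hd
  set k := pebble ⟨2, hn⟩ d with hkdef
  have hD : ∀ r, Descends hn d k N r := fun r => descends_of_survives (hsur r)
  have hk : IsPebbling n (n + 2) ⟨2, hn⟩ d k := pebble_spec (hn := hn) (hsur 0).1
  have hmem : ∀ r, ∀ p, Function.update d ⟨2, hn⟩ (k r) p ∈ ((N r).nodes : Set ℕ) := by
    intro r p
    by_cases hp : p = ⟨2, hn⟩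
    · subst hp
      rw [Function.update_self]
      exact (hD r).apex_mem r le_rfl
    · rw [Function.update_of_ne hp]
      exact (hD r).face_mem p hp
  have hlab : ∀ r s, s ≤ r → r ≤ s + 2 → rainbowLabel (N r)
      (Function.update (Function.update d ⟨2, hn⟩ (k r)) ⟨2, hn⟩ (k s)) =
        cherryAtom hn (-(s : ℤ)) := by
    intro r s h1 h2
    rw [Function.update_idem]
    exact (hD r).label s h1 h2
  -- colours are kept in the next round
  have hkeep : ∀ r c, IsNetwork.Coloured ((N (r + 1)).nodes : Set ℕ) (rainbowLabel (N (r + 1)))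
      (k (r + 1)) (k r) c → IsNetwork.Coloured ((N (r + 2)).nodes : Set ℕ)
        (rainbowLabel (N (r + 2))) (k (r + 1)) (k r) c := by
    intro r c hc
    have hR := (hsur (r + 2)).2 (r + 1) (by omega)
    rw [descendingStrategy_move] at hR
    -- A tuple made only of the two older apexes avoids the new pebble, so its label is preserved.
    let ε : Fin n → ℕ := fun p => if p.val = 0 then k (r + 1) else k r
    have hε : ∀ p, ε p = k (r + 1) ∨ ε p = k r := fun p => by
      simp only [ε]; split_ifs <;> simp
    have hε1 : ∀ p, ε p ∈ (N (r + 1)).nodes := fun p => by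
      rcases hε p with h | h <;> rw [h]
      · exact (hD (r + 1)).apex_mem _ le_rfl
      · exact (hD (r + 1)).apex_mem _ (by omega)
    have hε2 : ∀ p, ε p ∈ (N (r + 2)).nodes := fun p => by
      rcases hε p with h | h <;> rw [h]
      · exact (hD (r + 2)).apex_mem _ (by omega)
      · exact (hD (r + 2)).apex_mem _ (by omega)
    have heq : rainbowLabel (N (r + 2)) ε = rainbowLabel (N (r + 1)) ε := by
      refine rainbowLabel_eq ?_
      rw [toAtom_rainbowLabel]
      refine hR.agree ε fun p => ⟨hε1 p, ?_⟩
      rcases hε p with h | h <;> rw [h]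
      · exact (hk.ne_one (r + 1)).symm
      · exact (hk.ne_two r).symm
    have h01 := hc ε ⟨0, by omega⟩ ⟨1, by omega⟩ hε1 (by simp) rfl rfl
    rw [← heq] at h01
    exact (isNetwork_rainbowLabel (N (r + 2))).coloured hn hε2 (by simp) h01
  -- The newer apex comes first, as it has the smaller tint; each round strictly lowers `a`.
  have hdesc : ∀ a r b : ℕ, ¬ IsNetwork.Coloured ((N (r + 1)).nodes : Set ℕ)
      (rainbowLabel (N (r + 1))) (k (r + 1)) (k r) (.red a b) := by
    intro a
    induction a using Nat.strong_induction_on with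
    | _ a ih =>
      intro r b hc
      obtain ⟨m, hm, hcol⟩ := (isNetwork_rainbowLabel (N (r + 2))).red_eq hn (hmem (r + 2))
        ((hD (r + 2)).apex_mem (r + 2) le_rfl) ((hD (r + 2)).apex_mem (r + 1) (by omega))
        ((hD (r + 2)).apex_mem r (by omega)) (by push_cast; omega) (by push_cast; omega)
        (hlab _ _ le_rfl (by omega)) (hlab _ _ (by omega) (by omega))
        (hlab _ _ (by omega) (by omega)) (hkeep r _ hc)
      exact ih m hm (r + 1) a hcol
  obtain ⟨a, b, _, hc⟩ := (isNetwork_rainbowLabel (N 1)).exists_red hn (hmem 1)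
    ((hD 1).apex_mem 1 le_rfl) ((hD 1).apex_mem 0 (by omega)) (by simp)
    (hlab 1 1 le_rfl (by omega)) (hlab 1 0 (by omega) (by omega))
  exact hdesc a 0 b hc

end play

theorem forallWinsF (hn : 3 ≤ n) :
    ForallWinsF (n + 2) (atomStructure n (RainbowAlgebra n)) :=
  ⟨descendingStrategy hn, fun _ =>
    ⟨fun _ h => descendingStrategy_legal h, descendingStrategy_wins⟩⟩

end game

end Rainbow

namespace CylindricAlgebra

/-! ### Substitutions in cylindric algebras -/

open CylindricOps

variable {ι D : Type*} [BooleanAlgebra D] [CylindricAlgebra ι D] {i j k p q r : ι} {x y w E F : D}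

theorem cyl_mono (i : ι) (h : x ≤ y) : cyl i x ≤ cyl i y := by
  have h1 := cyl_inf_cyl i x y
  rw [inf_eq_left.mpr (h.trans (le_cyl i y))] at h1
  exact inf_eq_left.mp h1.symm

theorem eq_bot_of_cyl (i : ι) (h : cyl i x = ⊥) : x = ⊥ :=
  le_bot_iff.mp (h ▸ le_cyl i x)

theorem cyl_inf_of_right_fixed (hy : cyl i y = y) (x : D) : cyl i (x ⊓ y) = cyl i x ⊓ y := by
  have := cyl_inf_cyl i x y
  rwa [hy] at this

theorem cyl_diag_eq_top (h : k ≠ i) : cyl k (diag k i : D) = ⊤ := by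
  have h1 : (diag i i : D) = _ := diag_eq i i k h h
  rw [diag_self] at h1
  exact top_le_iff.mp (h1.le.trans (cyl_mono k inf_le_right))

/-- Any part of the left side outside `x` lies below both factors of the axiom `cyl_diag`. -/
theorem diag_inf_cyl_le (h : i ≠ j) (x : D) : diag i j ⊓ cyl i (diag i j ⊓ x) ≤ x := by
  rw [← disjoint_compl_right_iff, disjoint_iff, ← le_bot_iff, ← cyl_diag i j x h]
  refine le_inf (inf_le_left.trans inf_le_right) (le_trans ?_ (le_cyl i _))
  exact inf_le_inf inf_le_left le_rfl

theorem diag_le_symm (h : i ≠ j) : (diag i j : D) ≤ diag j i := by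
  have h1 : cyl i (diag i j ⊓ diag j i : D) = ⊤ := by
    rw [inf_comm, ← diag_eq j j i h h, diag_self]
  have h2 := cyl_diag i j (diag j i : D) h
  rw [h1, top_inf_eq] at h2
  rw [← disjoint_compl_right_iff, disjoint_iff]
  exact eq_bot_of_cyl i h2

theorem diag_symm (i j : ι) : (diag i j : D) = diag j i := by
  by_cases h : i = j
  · rw [h]
  · exact le_antisymm (diag_le_symm h) (diag_le_symm (Ne.symm h))

theorem diag_trans (hi : j ≠ i) (hk : j ≠ k) : (diag i j ⊓ diag j k : D) ≤ diag i k := by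
  rw [diag_eq i k j hi hk]
  exact le_cyl j _

/-- The substitution of `q` for `p`. -/
def subst (p q : ι) (E : D) : D := cyl p (diag p q ⊓ E)

/-- The element that forgets `p` and then sets it equal to `q`. -/
def move (p q : ι) (w : D) : D := diag p q ⊓ cyl p w

theorem subst_mono (p q : ι) (h : E ≤ F) : subst p q E ≤ subst p q F :=
  cyl_mono p (inf_le_inf le_rfl h)

theorem cyl_subst_self (p q : ι) (E : D) : cyl p (subst p q E) = subst p q E := cyl_cyl _ _

theorem cyl_subst (hp : j ≠ p) (hq : j ≠ q) (hE : cyl j E = E) :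
    cyl j (subst p q E) = subst p q E := by
  unfold subst
  rw [cyl_comm, cyl_inf_of_fixed (cyl_diag_of_ne hp hq) hE]

/-- Projecting away the substituted index leaves only the existence of a value for `p`; this is what
lets a new apex be placed at a spare index. -/
theorem cyl_subst_new (h : q ≠ p) (hE : cyl q E = E) : cyl q (subst p q E) = cyl p E := by
  unfold subst
  rw [cyl_comm, cyl_inf_of_right_fixed hE, diag_symm, cyl_diag_eq_top h, top_inf_eq]

theorem move_ne_bot (h : p ≠ q) (hw : w ≠ ⊥) : move p q w ≠ ⊥ := by
  intro h0
  have h1 : cyl p (diag p q ⊓ cyl p w) = ⊥ := by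
    change cyl p (move p q w) = ⊥
    rw [h0, cyl_bot]
  rw [cyl_inf_cyl, cyl_diag_eq_top h, top_inf_eq] at h1
  exact hw (eq_bot_of_cyl p h1)

theorem move_le_diag (p q : ι) (w : D) : move p q w ≤ diag p q := inf_le_left

theorem move_le_of_fixed (q : ι) (hF : cyl p F = F) (h : w ≤ F) : move p q w ≤ F :=
  inf_le_right.trans ((cyl_mono p h).trans hF.le)

theorem move_le_of_subst (hpq : p ≠ q) (h : w ≤ subst p q E) : move p q w ≤ E :=
  (le_inf (move_le_diag p q w) (move_le_of_fixed q (cyl_subst_self p q E) h)).trans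
    (diag_inf_cyl_le hpq E)

/-- Pulls information read after a move back to `w`, whose coordinate `p` is still intact: `move p q
w ⊓ E` lies below `cyl p (w ⊓ subst p q E)`. -/
theorem inf_subst_ne_bot (h : move p q w ⊓ E ≠ ⊥) : w ⊓ subst p q E ≠ ⊥ := by
  intro h0
  apply h
  have h1 := cyl_inf_cyl p w (diag p q ⊓ E)
  change cyl p (w ⊓ subst p q E) = _ at h1
  rw [h0, cyl_bot] at h1
  rw [← le_bot_iff, h1]
  exact le_inf (inf_le_left.trans inf_le_right)
    (le_trans (inf_le_inf (move_le_diag p q w) le_rfl) (le_cyl p _))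

theorem diag_inf_subst_le (hpr : p ≠ r) (hpq : p ≠ q) (hqr : q ≠ r) (E : D) :
    diag r q ⊓ subst p q E ≤ subst p r E := by
  unfold subst
  rw [inf_comm, ← cyl_inf_of_right_fixed (cyl_diag_of_ne hpr hpq)]
  refine cyl_mono p (le_inf ?_ (inf_le_left.trans inf_le_right))
  refine le_trans ?_ (diag_trans (Ne.symm hpq) hqr)
  rw [diag_symm q r]
  exact inf_le_inf inf_le_left le_rfl

theorem diag_inf_subst_le_subst (hpr : p ≠ r) (hpk : p ≠ k) (E : D) :
    diag r k ⊓ subst p q E ≤ subst p q (diag r k ⊓ E) := by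
  unfold subst
  rw [inf_comm, ← cyl_inf_of_right_fixed (cyl_diag_of_ne hpr hpk), inf_assoc, inf_comm E]

/-- Moving `r` to `q` turns facts about `q` into facts about `r`. -/
theorem move_le_subst (hpr : p ≠ r) (hpq : p ≠ q) (hqr : q ≠ r) (hE : cyl r E = E)
    (h : w ≤ subst p q E) : move r q w ≤ subst p r E :=
  (le_inf (move_le_diag r q w)
    (move_le_of_fixed q (cyl_subst (Ne.symm hpr) (Ne.symm hqr) hE) h)).trans
    (diag_inf_subst_le hpr hpq hqr E)

theorem subst_le_of_diag (hF : cyl p F = F) (h : diag p q ⊓ E ≤ F) : subst p q E ≤ F :=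
  (cyl_mono p h).trans hF.le

end CylindricAlgebra

namespace Rainbow

open CylindricOps CylindricAlgebra

/-! ### Neat embeddings -/

section neat

variable {n : ℕ} {D : Type u} [BooleanAlgebra D] [CylindricAlgebra (Fin (n + 2)) D]
  {e : RainbowAlgebra n → neatReduct n 2 D} (he : IsCompleteEmbedding (Fin n) e)

/-- The element of `D` that says that the edge `(p, q)` has colour `c`. -/
def edgeElt (e : RainbowAlgebra n → neatReduct n 2 D) (p q : Fin n) (c : Option (EdgeColour n)) :
    D := (e ({x | edgeColour x p q = c} : Set (rainbowAtomStructure n).Atom)).1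

/-- The element of `D` given by an atom. -/
def atomElt (e : RainbowAlgebra n → neatReduct n 2 D) (x : (rainbowAtomStructure n).Atom) : D :=
  (e (single x)).1

include he

/-- For spare `j` this is membership in the neat reduct; for $j<n$ it holds because $T_j$ preserves
colours of edges avoiding `j`. -/
theorem cyl_edgeElt {p q : Fin n} (c : Option (EdgeColour n)) {j : Fin (n + 2)}
    (hp : j.val ≠ p.val) (hq : j.val ≠ q.val) : cyl j (edgeElt e p q c) = edgeElt e p q c := by
  by_cases hj : n ≤ j.val
  · exact (e _).2 j hj
  · obtain ⟨i, rfl⟩ : ∃ i : Fin n, j = Fin.castAdd 2 i := ⟨⟨j, by omega⟩, rfl⟩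
    have h1 := congrArg Subtype.val
      (he.map_cyl i ({x | edgeColour x p q = c} : Set (rainbowAtomStructure n).Atom))
    change _ = cyl (Fin.castAdd 2 i) (edgeElt e p q c) at h1
    rw [← h1]
    refine congrArg (fun X => (e X).1) (Set.ext fun x => ⟨?_, fun hx => ⟨x, hx, ?_⟩⟩)
    · rintro ⟨y, hy, hxy⟩
      exact (edgeColour_eq_of_rel hxy (fun h => hp (by simp [h])) (fun h => hq (by simp [h]))).trans
        hy
    · induction x using Quotient.inductionOn with | _ a
      exact GraphMap.AgreeOn.refl _ a

theorem diag_inf_edgeElt_le {i j p q p' q' : Fin n} {c c' : Option (EdgeColour n)}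
    (h : ∀ x ∈ (rainbowAtomStructure n).diag i j, edgeColour x p q = c → edgeColour x p' q' = c') :
    diag (Fin.castAdd 2 i) (Fin.castAdd 2 j) ⊓ edgeElt e p q c ≤ edgeElt e p' q' c' := by
  have h1 := congrArg Subtype.val (he.map_diag i j)
  have h2 := congrArg Subtype.val (he.map_inf (diag i j)
    ({x | edgeColour x p q = c} : Set (rainbowAtomStructure n).Atom))
  change _ = (e (diag i j)).1 ⊓ edgeElt e p q c at h2
  rw [h1] at h2
  change _ = diag (Fin.castAdd 2 i) (Fin.castAdd 2 j) ⊓ _ at h2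
  rw [← h2]
  exact he.mono fun x hx => h x hx.1 hx.2

theorem atomElt_le_edgeElt {x : (rainbowAtomStructure n).Atom} {p q : Fin n}
    {c : Option (EdgeColour n)} (h : edgeColour x p q = c) :
    atomElt e x ≤ edgeElt e p q c :=
  he.mono (by rintro _ rfl; exact h)

theorem edgeColour_of_le {x : (rainbowAtomStructure n).Atom} {p q : Fin n}
    {c : Option (EdgeColour n)} {w : D} (hx : w ⊓ atomElt e x ≠ ⊥) (h : w ≤ edgeElt e p q c) :
    edgeColour x p q = c := by
  by_contra hc
  apply hx
  have h1 := congrArg Subtype.val (he.map_inf (single x)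
    ({x | edgeColour x p q = c} : Set (rainbowAtomStructure n).Atom))
  rw [single_inf_eq_bot (X := ({x | edgeColour x p q = c} : Set _)) hc, he.map_bot] at h1
  change (⊥ : D) = atomElt e x ⊓ edgeElt e p q c at h1
  rw [← le_bot_iff, h1, inf_comm]
  exact inf_le_inf le_rfl h

/-- Every non-zero element of `D` is compatible with an atom. -/
theorem exists_atomElt {w : D} (hw : w ≠ ⊥) :
    ∃ x : (rainbowAtomStructure n).Atom, w ⊓ atomElt e x ≠ ⊥ := by
  by_contra! hc
  let a : Fin (n + 2) := Fin.natAdd n 0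
  let b : Fin (n + 2) := Fin.natAdd n 1
  -- Removing both spare dimensions lands in the neat reduct, where the supremum of the atoms is the
  -- unit; if `w` missed every atom, so would `v`.
  let v : D := cyl a (cyl b w)
  have hv : v ∈ neatReduct n 2 D := by
    intro j hj
    have : j = a ∨ j = b := by
      simp only [a, b, Fin.ext_iff, Fin.val_natAdd]
      have := j.2
      simp
      omega
    rcases this with rfl | rfl
    · exact cyl_cyl _ _
    · change cyl b (cyl a (cyl b w)) = cyl a (cyl b w)
      rw [cyl_comm, cyl_cyl]
  have hlub := he.map_isLUB _ _ (isLUB_range_single (rainbowAtomStructure n))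
  rw [he.map_top] at hlub
  have hle : (⊤ : neatReduct n 2 D) ≤ ⟨v, hv⟩ᶜ := by
    refine hlub.2 ?_
    rintro _ ⟨_, ⟨x, rfl⟩, rfl⟩
    rw [le_compl_iff_disjoint_left, disjoint_iff]
    apply Subtype.ext
    change v ⊓ atomElt e x = ⊥
    have ha : cyl a (atomElt e x) = atomElt e x := (e _).2 a (by simp [a])
    have hb : cyl b (atomElt e x) = atomElt e x := (e _).2 b (by simp [b])
    rw [← cyl_inf_of_right_fixed ha, ← cyl_inf_of_right_fixed hb, hc x, cyl_bot, cyl_bot]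
  have hle' : (⊤ : D) ≤ vᶜ := hle
  have hbot : v = ⊥ := by rwa [top_le_iff, compl_eq_top] at hle'
  exact hw (eq_bot_of_cyl b (eq_bot_of_cyl a hbot))

theorem cyl_cherryAtom (hn : 3 ≤ n) (t : ℤ) :
    cyl (Fin.castAdd 2 ⟨2, hn⟩) (atomElt e (cherryAtom hn t)) =
      cyl (Fin.castAdd 2 ⟨2, hn⟩) (atomElt e (cherryAtom hn 0)) := by
  have key : ∀ s t : ℤ, atomElt e (cherryAtom hn s) ≤
      cyl (Fin.castAdd 2 ⟨2, hn⟩) (atomElt e (cherryAtom hn t)) := by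
    intro s t
    have h1 := congrArg Subtype.val (he.map_cyl ⟨2, hn⟩ (single (cherryAtom hn t)))
    change _ = cyl (Fin.castAdd 2 ⟨2, hn⟩) (atomElt e (cherryAtom hn t)) at h1
    rw [← h1]
    exact he.mono (single_le_cyl_single.mpr (cherryAtom_rel hn s t))
  apply le_antisymm
  · exact (cyl_mono _ (key t 0)).trans (cyl_cyl _ _).le
  · exact (cyl_mono _ (key 0 t)).trans (cyl_cyl _ _).le

/-- The edge between the apexes of two triangles, at the indices `2` and `q`, is red. -/
theorem exists_red_subst (hn : 3 ≤ n) {q : Fin (n + 2)} (hq : n ≤ q.val) {s t : ℤ} (hst : s < t)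
    {w : D} (hw : w ≠ ⊥) (ht : w ≤ atomElt e (cherryAtom hn t))
    (hs : w ≤ subst (Fin.castAdd 2 ⟨2, hn⟩) q (atomElt e (cherryAtom hn s))) :
    ∃ k l, k < l ∧ w ⊓ subst (Fin.castAdd 2 ⟨1, by omega⟩) q
      (edgeElt e ⟨1, by omega⟩ ⟨2, hn⟩ (some (.red k l))) ≠ ⊥ := by
  let o : Fin n := ⟨0, by omega⟩
  let i : Fin n := ⟨1, by omega⟩
  let j : Fin n := ⟨2, hn⟩
  have hne : ∀ p : Fin n, Fin.castAdd 2 p ≠ q := fun p h => by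
    have := p.2
    rw [← h, Fin.val_castAdd] at hq
    omega
  have hoi : Fin.castAdd 2 o ≠ Fin.castAdd 2 i := by simp [o, i]
  have hoj : Fin.castAdd 2 o ≠ Fin.castAdd 2 j := by simp [o, j]
  have hij : Fin.castAdd 2 i ≠ Fin.castAdd 2 j := by simp [i, j]
  have hg := atomElt_le_edgeElt he (edgeColour_cherryAtom_green hn s)
  have hy := atomElt_le_edgeElt he (edgeColour_cherryAtom_yellow hn s)
  have hg' := ht.trans (atomElt_le_edgeElt he (edgeColour_cherryAtom_green hn t))
  have hy' := ht.trans (atomElt_le_edgeElt he (edgeColour_cherryAtom_yellow hn t))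
  -- the indices `0, 1, 2` on the left node and the two apexes
  let v := move (Fin.castAdd 2 i) q w
  have hv : v ≠ ⊥ := move_ne_bot (hne i) hw
  have hv02 : v ≤ edgeElt e o j (some (.greenZero t)) :=
    move_le_of_fixed q (cyl_edgeElt he _ (by simp [i, o]) (by simp [i, j])) hg'
  have hv01 : v ≤ edgeElt e o i (some (.greenZero s)) := by
    refine (move_le_subst (p := Fin.castAdd 2 j) (E := edgeElt e o j (some (.greenZero s)))
      hij.symm (hne j) (hne i).symm (cyl_edgeElt he _ (by simp [i, o]) (by simp [i, j]))
      (hs.trans (subst_mono _ _ hg))).trans ?_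
    refine subst_le_of_diag (cyl_edgeElt he _ (by simp [o, j]) (by simp [i, j])) ?_
    exact diag_inf_edgeElt_le he fun x hx h => by rw [← edgeColour_right_of_diag hx, h]
  obtain ⟨x, hx⟩ := exists_atomElt he hv
  have hx01 := edgeColour_of_le he hx hv01
  have hx02 := edgeColour_of_le he hx hv02
  cases hc : edgeColour x i j with
  | none =>
    have := edgeColour_right_of_diag (mem_diag_of_edgeColour hc) o
    rw [hx01, hx02] at this
    cases this
    exact (lt_irrefl _ hst).elim
  | some c =>
    -- The move to index 1 lost the yellow end of the base. The colour found is recorded on `w`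
    -- itself, so that a second move, over index 0, can test it against the yellows.
    have hw₁ : w ⊓ subst (Fin.castAdd 2 i) q (edgeElt e i j (some c)) ≠ ⊥ := by
      refine inf_subst_ne_bot fun h => hx (le_bot_iff.mp (h ▸ ?_))
      exact inf_le_inf le_rfl (atomElt_le_edgeElt he hc)
    -- the indices `0, 1, 2` on the first apex, the right node and the second apex
    have hu := move_ne_bot (hne o) hw₁
    obtain ⟨x', hx'⟩ := exists_atomElt he hu
    have h12 : edgeColour x' i j = some .yellow := edgeColour_of_le he hx' <|
      move_le_of_fixed q (cyl_edgeElt he _ (by simp [i, o]) (by simp [o, j]))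
        (inf_le_left.trans hy')
    have h10 : edgeColour x' i o = some .yellow := by
      refine edgeColour_of_le he hx' ?_
      refine (move_le_subst (p := Fin.castAdd 2 j) (E := edgeElt e i j (some .yellow))
        hoj.symm (hne j) (hne o).symm (cyl_edgeElt he _ (by simp [i, o]) (by simp [o, j]))
        (inf_le_left.trans (hs.trans (subst_mono _ _ hy)))).trans ?_
      refine subst_le_of_diag (cyl_edgeElt he _ (by simp [i, j]) (by simp [o, j])) ?_
      exact diag_inf_edgeElt_le he fun x hx h => by rw [← edgeColour_right_of_diag hx, h]
    have h02 : edgeColour x' o j = some c := by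
      refine edgeColour_of_le he hx' ?_
      refine (move_le_subst (p := Fin.castAdd 2 i) (E := edgeElt e i j (some c))
        hoi.symm (hne i) (hne o).symm (cyl_edgeElt he _ (by simp [i, o]) (by simp [o, j]))
        inf_le_right).trans ?_
      refine subst_le_of_diag (cyl_edgeElt he _ (by simp [i, o]) (by simp [i, j])) ?_
      exact diag_inf_edgeElt_le he fun x hx h => by rw [← edgeColour_left_of_diag hx, h]
    obtain ⟨k, l, hkl, rfl⟩ := exists_red_of_not_forbidden hst
      (not_forbidden_edgeColour hx01 hx02 hc) (not_forbidden_edgeColour h10 h12 h02)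
    exact ⟨k, l, hkl, hw₁⟩

end neat

/-! ### The descent in the spare dimensions. -/

theorem not_isCompleteSubNeatReduct {n : ℕ} (hn : 3 ≤ n) :
    ¬ IsCompleteSubNeatReduct.{0, u} n 2 (RainbowAlgebra n) := by
  rintro ⟨D, _, _, e, he⟩
  let o : Fin n := ⟨0, by omega⟩
  let i : Fin n := ⟨1, by omega⟩
  let j : Fin n := ⟨2, hn⟩
  let o' : Fin (n + 2) := Fin.castAdd 2 o
  let i' : Fin (n + 2) := Fin.castAdd 2 i
  let j' : Fin (n + 2) := Fin.castAdd 2 j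
  let y : Fin (n + 2) := Fin.natAdd n 0
  let z : Fin (n + 2) := Fin.natAdd n 1
  have hoi : o' ≠ i' := by simp [o', i', o, i]
  have hoj : o' ≠ j' := by simp [o', j', o, j]
  have hij : i' ≠ j' := by simp [i', j', i, j]
  have hne : ∀ (p : Fin n) (q : Fin 2), Fin.castAdd 2 p ≠ Fin.natAdd n q := fun p q h => by
    have := p.2
    have h' := congrArg Fin.val h
    simp only [Fin.val_castAdd, Fin.val_natAdd] at h'
    omega
  have hyz : y ≠ z := by simp [y, z, Fin.ext_iff]
  have hzy := hyz.symm
  have hoy : o' ≠ y := hne o 0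
  have hoz : o' ≠ z := hne o 1
  have hiy : i' ≠ y := hne i 0
  have hiz : i' ≠ z := hne i 1
  have hjy : j' ≠ y := hne j 0
  have hjz : j' ≠ z := hne j 1
  have hny : n ≤ y.val := by simp [y]
  have hnz : n ≤ z.val := by simp [z]
  let A : ℤ → D := fun t => atomElt e (cherryAtom hn t)
  let R : ℕ → ℕ → D := fun k l => edgeElt e i j (some (.red k l))
  have hAq : ∀ t (q : Fin (n + 2)), n ≤ q.val → cyl q (A t) = A t := fun t q hq => (e _).2 q hq
  have hAy := fun t => hAq t y hny
  have hAz := fun t => hAq t z hnz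
  have hR : ∀ k l (q : Fin (n + 2)), q ≠ i' → q ≠ j' → cyl q (R k l) = R k l :=
    fun k l q hi hj => cyl_edgeElt he _ (fun h => hi (Fin.ext h)) (fun h => hj (Fin.ext h))
  -- a new apex can be placed at any free index
  have hnew : ∀ (q : Fin (n + 2)), n ≤ q.val → ∀ (w : D) (s t : ℤ), w ≠ ⊥ → w ≤ A s →
      cyl q w = w → w ⊓ subst j' q (A t) ≠ ⊥ := by
    intro q hq w s t hw hws hqw h
    have hqj : q ≠ j' := fun h => by
      have := congrArg Fin.val h
      simp only [j', j, Fin.val_castAdd] at this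
      omega
    -- All atoms `A t` have the same cylindrification at index 2, and it lies above `w`; so this
    -- projection is `w` itself.
    have h1 : cyl q (subst j' q (A t) ⊓ w) = ⊥ := by rw [inf_comm, h, cyl_bot]
    rw [cyl_inf_of_right_fixed hqw, cyl_subst_new hqj (hAq t q hq), cyl_cherryAtom he hn t,
      ← cyl_cherryAtom he hn s, inf_eq_right.mpr (hws.trans (le_cyl _ _))] at h1
    exact hw h1
  -- Invariant: the apex with tint `t` at index 2, that with tint `t - 1` at `y`, and the edge `(y,
  -- 2)` red with first index `k`.
  have hdesc : ∀ k : ℕ, ∀ (t : ℤ) (l : ℕ) (w : D), w ≠ ⊥ → w ≤ A t →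
      w ≤ subst j' y (A (t - 1)) → ¬ w ≤ subst i' y (R k l) := by
    intro k
    induction k using Nat.strong_induction_on with
    | _ k ih =>
    intro t l w₀ hw₀ h2 hy hr
    -- the third apex, at the index `z`
    have hcz : cyl z w₀ ≠ ⊥ := fun h => hw₀ (eq_bot_of_cyl z h)
    -- Index `z` is freed for the third apex; facts not mentioning `z` survive.
    have hle : ∀ F : D, cyl z F = F → w₀ ≤ F → cyl z w₀ ≤ F := fun F hF h =>
      (cyl_mono z h).trans hF.le
    have hw₁ := hnew z hnz _ t (t - 1 - 1) hcz (hle _ (hAz _) h2) (cyl_cyl _ _)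
    obtain ⟨m, l', hml', hw₂⟩ := exists_red_subst he hn hnz (by omega : t - 1 - 1 < t) hw₁
      (inf_le_left.trans (hle _ (hAz _) h2)) inf_le_right
    set w₂ := cyl z w₀ ⊓ subst j' z (A (t - 1 - 1)) ⊓ subst i' z (R m l') with hw₂def
    have h2' : w₂ ≤ A t := inf_le_left.trans (inf_le_left.trans (hle _ (hAz _) h2))
    have hy' : w₂ ≤ subst j' y (A (t - 1)) := inf_le_left.trans
      (inf_le_left.trans (hle _ (cyl_subst hjz.symm hzy (hAz _)) hy))
    have hr' : w₂ ≤ subst i' y (R k l) := inf_le_left.trans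
      (inf_le_left.trans (hle _ (cyl_subst hiz.symm hzy (hR _ _ _ hiz.symm hjz.symm)) hr))
    have hz' : w₂ ≤ subst j' z (A (t - 1 - 1)) := inf_le_left.trans inf_le_right
    have hr2 : w₂ ≤ subst i' z (R m l') := inf_le_right
    clear_value w₂
    -- the edge between `z` and `y`
    obtain ⟨m', k', hmk', hw₃⟩ := exists_red_subst he hn hnz (by omega : t - 1 - 1 < t - 1)
      (move_ne_bot hjy hw₂) (move_le_of_subst hjy hy')
      (move_le_of_fixed y (cyl_subst_self _ _ _) hz')
    change move j' y w₂ ⊓ subst i' z (R m' k') ≠ ⊥ at hw₃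
    -- The colour of `(z, y)` was read with index 2 moved to `y`; pulling it back restores the apex
    -- at index 2.
    have hw₄ := inf_subst_ne_bot hw₃
    set w := w₂ ⊓ subst j' y (subst i' z (R m' k')) with hwdef
    have hr3 : w ≤ subst j' y (subst i' z (R m' k')) := inf_le_right
    have hww : w ≤ w₂ := inf_le_left
    clear_value w
    -- the three red edges form a triangle
    let v := move o' y (move i' z w)
    obtain ⟨x, hx⟩ := exists_atomElt he (move_ne_bot hoy (move_ne_bot hiz hw₄) : v ≠ ⊥)
    have hRo : ∀ a b, cyl o' (R a b) = R a b := fun a b => hR a b o' hoi hoj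
    have hx12 : edgeColour x i j = some (.red m l') := edgeColour_of_le he hx <|
      move_le_of_fixed y (hRo _ _) (move_le_of_subst hiz (hww.trans hr2))
    have hx02 : edgeColour x o j = some (.red k l) := by
      refine edgeColour_of_le he hx ?_
      refine (move_le_subst (p := i') (E := R k l) hoi.symm hiy hoy.symm (hRo _ _)
        (move_le_of_fixed z (cyl_subst_self _ _ _) (hww.trans hr'))).trans ?_
      refine subst_le_of_diag (cyl_edgeElt he _ (by simp [i', i, o]) (by simp [i', i, j])) ?_
      exact diag_inf_edgeElt_le he fun x hx h => by rw [← edgeColour_left_of_diag hx, h]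
    have hx10 : edgeColour x i o = some (.red m' k') := by
      refine edgeColour_of_le he hx ?_
      -- The equality of indices 1 and `z` passes under the substitution at index 2 and cancels the
      -- inner one.
      have h1 : move i' z w ≤ subst j' y (R m' k') := by
        have h2 := move_le_of_fixed z (cyl_subst hij hiy (cyl_subst_self _ _ _)) hr3
        refine (le_inf (move_le_diag _ _ _) h2).trans ((diag_inf_subst_le_subst hij.symm hjz _).trans
          (subst_mono _ _ (diag_inf_cyl_le hiz _)))
      refine (move_le_subst (p := j') hoj.symm hjy hoy.symm (hRo _ _) h1).trans ?_
      refine subst_le_of_diag (cyl_edgeElt he _ (by simp [j', i, j]) (by simp [j', o, j])) ?_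
      exact diag_inf_edgeElt_le he fun x hx h => by rw [← edgeColour_right_of_diag hx, h]
    have hx01 : edgeColour x o i = some (.red k' m') := by rw [edgeColour_symm, hx10]; rfl
    have hkk : k' = k := by
      by_contra hne
      exact not_forbidden_edgeColour hx01 hx02 hx12 (.reds _ _ _ _ _ _ fun h => hne h.1)
    subst hkk
    -- forget the first apex and shift the other two
    have hu := move_ne_bot hyz (move_ne_bot hjy hw₄)
    -- Index 2 now holds the apex with tint `t - 1` and `y` the one with tint `t - 2`; `m'` is below
    -- the old first index.
    refine ih m' hmk' (t - 1) k' _ hu ?_ ?_ ?_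
    · exact move_le_of_fixed z (hAy _) (move_le_of_subst hjy (hww.trans hy'))
    · exact move_le_subst hjy hjz hzy (hAy _)
        (move_le_of_fixed y (cyl_subst_self _ _ _) (hww.trans hz'))
    · exact move_le_subst hiy hiz hzy (hR _ _ _ hiy.symm hjy.symm) (move_le_of_subst hjy hr3)
  have hA0 : A 0 ≠ ⊥ := by
    intro h
    have h1 : e (single (cherryAtom hn 0)) = e ⊥ := by
      rw [he.map_bot]
      exact Subtype.ext h
    exact single_ne_bot _ (he.injective h1)
  have hw := hnew y hny _ 0 (0 - 1) hA0 le_rfl (hAy 0)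
  obtain ⟨k, l, _, hkl⟩ := exists_red_subst he hn hny (by omega : (0 : ℤ) - 1 < 0) hw
    inf_le_left inf_le_right
  exact hdesc k 0 l _ hkl (inf_le_left.trans inf_le_left) (inf_le_left.trans inf_le_right)
    inf_le_right

end Rainbow

theorem mainTheorem5 (n : ℕ) (hn : 3 ≤ n) :
    ForallWinsF (n + 2) (atomStructure n (Rainbow.RainbowAlgebra n)) ∧
      ¬ IsCompleteSubNeatReduct.{0, u} n 2 (Rainbow.RainbowAlgebra n) ∧
      ¬ IsCompletelyRepresentable.{0, v} n (Rainbow.RainbowAlgebra n) :=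
  ⟨Rainbow.forallWinsF hn, Rainbow.not_isCompleteSubNeatReduct hn,
    Rainbow.not_isCompletelyRepresentable hn⟩
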